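/- **Conventions.** An F-manifold $(M,\circ,e)$ is a connected complex manifold $M$ of dimension $\ge 1$ with a holomorphic, commutative, associative, $\mathcal O_M$-bilinear multiplication $\circ$ on the tangent bundle and a global holomorphic unit field $e$, such that $\mathrm{Lie}_{X\circ Y}(\circ)=X\circ \mathrm{Lie}_Y(\circ)+Y\circ \mathrm{Lie}_X(\circ)$ for all local holomorphic vector fields $X,Y$. It is massive if the algebra $T_pM$ is semisimple (isomorphic to $\mathbb C^{\dim M}$) for generic $p$. An Euler field of weight $d\in\mathbb C$ is a holomorphic vector field $E$ with $\mathrm{Lie}_E(\circ)=d\cdot\circ$. Two germs are isomorphic if a biholomorphic map germ carries multiplication to multiplication and unit field to unit field; a germ is irreducible if it is not isomorphic to a product of two germs of F-manifolds (of dimensions $\ge1$). The caustic $\mathcal K$ is the set of points $p$ at which the decomposition of $T_pM$ into simultaneous generalized eigenspaces has fewer components than at generic points. The analytic spectrum $L\subset T^*M$ is the set of unital algebra homomorphisms $\chi:T_pM\to\mathbb C$, $p\in M$. For an Euler field $E$ of weight $1$, with generating function $F(\chi)=\chi(E)$ on $L$, the discriminant $\mathcal D$ is the image in $M$ of $F^{-1}(0)$,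 and the bifurcation diagram $\mathcal B$ is the set of points over which $F$ has fewer than $\dim M$ values. On $\mathbb C^2$ with coordinates $t_1,t_2$ put $\partial_i=\partial/\partial t_i$. **Theorem 12.1.** (a) For $m\ge 2$ let $I_2(m)$ be $\mathbb C^2$ with $e=\partial_1$ and $\partial_2\circ\partial_2=t_2^{m-2}\partial_1$. Each $I_2(m)$ is a massive F-manifold, and every germ $(M,p)$ of a 2-dimensional massive F-manifold is isomorphic to the germ $(I_2(m),0)$ for exactly one $m\ge 2$. The germ of $I_2(2)$ at $0$ is isomorphic to that of $A_1^2$, i.e. of $\mathbb C^2$ with $e_i\circ e_j=\delta_{ij}e_i$ for the coordinate fields $e_1,e_2$ and with unit field $e_1+e_2$. For every $m\ge2$, $E=t_1\partial_1+\frac2m t_2\partial_2$ is an Euler field of weight $1$ on $I_2(m)$, with discriminant $$\mathcal D=\Big\{t\in\mathbb C^2 \;\Big|\; t_1^2-\frac{4}{m^2}t_2^m=0\Big\}.$$ For $m\ge3$ the germ of $I_2(m)$ at $0$ is irreducible, the caustic and the bifurcation diagram are $\mathcal K=\mathcal B=\{t\mid t_2=0\}$, and for every $d\in\mathbb C$ the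 set of germs at $0$ of Euler fields of weight $d$ is $d\cdot E+\mathbb C\cdot e$. (b) The plane $\mathbb C^2$ with $e=\partial_1$ and $\partial_2\circ\partial_2=0$ is an F-manifold that is not massive, and every germ of a 2-dimensional F-manifold that is not massive is isomorphic to its germ at $0$. Its caustic is empty, $t_1\partial_1$ is an Euler field of weight $1$ on it, and the space of germs at $0$ of its Euler fields of weight $0$ is $$\{\varepsilon_1\partial_1+\varepsilon_2(t_2)\partial_2 \mid \varepsilon_1\in\mathbb C,\ \varepsilon_2\in\mathbb C\{t_2\}\}.$$ -/

import Mathlib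

open scoped Manifold ContDiff Topology

namespace FMfd

section General

universe u v w

variable {E : Type u} [NormedAddCommGroup E] [NormedSpace ℂ E]
  {H : Type v} [TopologicalSpace H] (I : ModelWithCorners ℂ E H)
  (M : Type w) [TopologicalSpace M] [ChartedSpace H M]

/-- The raw data of a bilinear multiplication on the tangent spaces of `M` and of a vector field
`unit`. All laws (holomorphy, commutativity, ...) are collected in `IsFManifold`. -/
structure TangentMul where
  mul : ∀ p : M, TangentSpace I p →ₗ[ℂ] TangentSpace I p →ₗ[ℂ] TangentSpace I p
  unit : ∀ p : M, TangentSpace I p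

variable {I M}

/-- `X` is a holomorphic vector field on the set `U` (in use, `U` is open). -/
def HolomorphicOn [IsManifold I ω M] (X : ∀ p : M, TangentSpace I p) (U : Set M) : Prop :=
  ContMDiffOn I I.tangent ω (fun p => (⟨p, X p⟩ : TangentBundle I M)) U

namespace TangentMul

/-- The pointwise product `X ∘ Y` of two vector fields. -/
noncomputable def mulField (A : TangentMul I M) (X Y : ∀ p : M, TangentSpace I p) :
    ∀ p : M, TangentSpace I p :=
  fun p => A.mul p (X p) (Y p)

/-- The Lie derivative of the multiplication, seen as a (2,1)-tensor:
`(Lie_X ∘)(Y, Z) = [X, Y ∘ Z] - [X, Y] ∘ Z - Y ∘ [X, Z]`. -/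
noncomputable def lieMul (A : TangentMul I M) (X Y Z : ∀ p : M, TangentSpace I p) :
    ∀ p : M, TangentSpace I p :=
  fun p => VectorField.mlieBracket I X (A.mulField Y Z) p
    - A.mul p (VectorField.mlieBracket I X Y p) (Z p)
    - A.mul p (Y p) (VectorField.mlieBracket I X Z p)

/-- `(M, ∘, e)` is an F-manifold: `M` is a connected complex manifold of finite dimension `≥ 1`,
the multiplication is holomorphic, commutative and associative with holomorphic unit field `e`, and
`Lie_{X ∘ Y}(∘) = X ∘ Lie_Y(∘) + Y ∘ Lie_X(∘)` for all local holomorphic vector fields `X`, `Y`. -/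
structure IsFManifold [IsManifold I ω M] (A : TangentMul I M) : Prop where
  connected : ConnectedSpace M
  dim_pos : 0 < Module.finrank ℂ E
  mul_comm : ∀ (p : M) (u v : TangentSpace I p), A.mul p u v = A.mul p v u
  mul_assoc : ∀ (p : M) (u v w : TangentSpace I p),
    A.mul p (A.mul p u v) w = A.mul p u (A.mul p v w)
  unit_mul : ∀ (p : M) (u : TangentSpace I p), A.mul p (A.unit p) u = u
  holomorphic_unit : HolomorphicOn A.unit Set.univ
  holomorphic_mul : ∀ (U : Set M), IsOpen U → ∀ X Y : ∀ p : M, TangentSpace I p,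
    HolomorphicOn X U → HolomorphicOn Y U → HolomorphicOn (A.mulField X Y) U
  lie_mul : ∀ (U : Set M), IsOpen U → ∀ X Y Z W : ∀ p : M, TangentSpace I p,
    HolomorphicOn X U → HolomorphicOn Y U → HolomorphicOn Z U → HolomorphicOn W U →
    ∀ p ∈ U, A.lieMul (A.mulField X Y) Z W p
      = A.mul p (X p) (A.lieMul Y Z W p) + A.mul p (Y p) (A.lieMul X Z W p)

/-- `X` is an Euler field of weight `d` on the open set `U`: `X` is holomorphic on `U` and
`Lie_X(∘) = d · ∘` there. -/
def IsEulerFieldOn [IsManifold I ω M] (A : TangentMul I M) (U : Set M) (d : ℂ)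
    (X : ∀ p : M, TangentSpace I p) : Prop :=
  IsOpen U ∧ HolomorphicOn X U ∧
    ∀ V ⊆ U, IsOpen V → ∀ Y Z : ∀ p : M, TangentSpace I p,
      HolomorphicOn Y V → HolomorphicOn Z V →
      ∀ p ∈ V, A.lieMul X Y Z p = d • A.mul p (Y p) (Z p)

/-- A (global) Euler field of weight `d`. -/
def IsEulerField [IsManifold I ω M] (A : TangentMul I M) (d : ℂ)
    (X : ∀ p : M, TangentSpace I p) : Prop :=
  A.IsEulerFieldOn Set.univ d X

/-- The germ of `X` at `p` is an Euler field of weight `d` on the germ `(M, p)`. -/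
def IsEulerGermAt [IsManifold I ω M] (A : TangentMul I M) (p : M) (d : ℂ)
    (X : ∀ p : M, TangentSpace I p) : Prop :=
  ∃ U : Set M, p ∈ U ∧ A.IsEulerFieldOn U d X

/-- The algebra `T_p M` is semisimple: it has a basis `b` with `b i ∘ b j = δ_{ij} b i`. -/
def IsSemisimpleAt (A : TangentMul I M) (p : M) : Prop :=
  ∃ (n : ℕ) (b : Module.Basis (Fin n) ℂ (TangentSpace I p)),
    ∀ i j, A.mul p (b i) (b j) = if i = j then b i else 0

/-- Massive: the multiplication is generically semisimple. -/
def IsMassive (A : TangentMul I M) : Prop :=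
  Dense {p : M | A.IsSemisimpleAt p}

/-- The fibre over `p` of the analytic spectrum (a subset of the cotangent bundle): the unital
algebra homomorphisms `T_p M → ℂ`. They correspond bijectively to the components of the
decomposition of `T_p M` into simultaneous generalized eigenspaces; the homomorphism is the
eigenvalue function of its component. -/
def spectrumFibre (A : TangentMul I M) (p : M) : Set (TangentSpace I p →ₗ[ℂ] ℂ) :=
  {χ | χ (A.unit p) = 1 ∧ ∀ u v, χ (A.mul p u v) = χ u * χ v}

/-- The caustic: the points `p` such that the eigenspace decomposition of `T_p M` has fewer
components than at generic points. -/
def caustic (A : TangentMul I M) : Set M :=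
  {p | ∃ U : Set M, IsOpen U ∧ Dense U ∧
    ∀ q ∈ U, (A.spectrumFibre p).ncard < (A.spectrumFibre q).ncard}

/-- The bifurcation diagram of an Euler field `X` of weight one: the points over which
the generating function `χ ↦ χ X` on the analytic spectrum has fewer than `dim M` values. -/
def bifurcationDiagram (A : TangentMul I M) (X : ∀ p : M, TangentSpace I p) : Set M :=
  {p | ((fun χ : TangentSpace I p →ₗ[ℂ] ℂ => χ (X p)) '' A.spectrumFibre p).ncard
    < Module.finrank ℂ E}

/-- The discriminant of an Euler field `X` of weight one: the image in `M` of the zero set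
of the generating function `χ ↦ χ X` on the analytic spectrum. -/
def discriminant (A : TangentMul I M) (X : ∀ p : M, TangentSpace I p) : Set M :=
  {p | ∃ χ ∈ A.spectrumFibre p, χ (X p) = 0}

end TangentMul

end General

section Germs

universe u v w u' v' w'

variable {E : Type u} [NormedAddCommGroup E] [NormedSpace ℂ E]
  {H : Type v} [TopologicalSpace H] {I : ModelWithCorners ℂ E H}
  {M : Type w} [TopologicalSpace M] [ChartedSpace H M]
  {E' : Type u'} [NormedAddCommGroup E'] [NormedSpace ℂ E']
  {H' : Type v'} [TopologicalSpace H'] {I' : ModelWithCorners ℂ E' H'}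
  {M' : Type w'} [TopologicalSpace M'] [ChartedSpace H' M']

/-- The germs `(M, p)` and `(M', p')` are isomorphic: there is a biholomorphic map from an open
neighbourhood of `p` to an open neighbourhood of `p'` that sends `p` to `p'` and respects
the multiplications and the unit fields. -/
def GermIso (A : TangentMul I M) (p : M) (A' : TangentMul I' M') (p' : M') : Prop :=
  ∃ φ : OpenPartialHomeomorph M M', p ∈ φ.source ∧ φ p = p' ∧
    ContMDiffOn I I' ω φ φ.source ∧ ContMDiffOn I' I ω φ.symm φ.target ∧
    ∀ q ∈ φ.source, mfderiv I I' φ q (A.unit q) = A'.unit (φ q) ∧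
      ∀ u v : TangentSpace I q, mfderiv I I' φ q (A.mul q u v)
        = A'.mul (φ q) (mfderiv I I' φ q u) (mfderiv I I' φ q v)

/-- The product: `M × M'` with the multiplication `∘ ⊕ ∘'` and the unit field `e + e'`. -/
noncomputable def TangentMul.prod (A : TangentMul I M) (A' : TangentMul I' M') :
    TangentMul (I.prod I') (M × M') where
  mul p := LinearMap.mk₂ ℂ
    (fun u v : E × E' =>
      ((A.mul p.1 (u.1 : E) (v.1 : E), A'.mul p.2 (u.2 : E') (v.2 : E')) : E × E'))
    (fun a b c => Prod.ext (LinearMap.map_add₂ (A.mul p.1) a.1 b.1 c.1)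
      (LinearMap.map_add₂ (A'.mul p.2) a.2 b.2 c.2))
    (fun r a c => Prod.ext (LinearMap.map_smul₂ (A.mul p.1) r a.1 c.1)
      (LinearMap.map_smul₂ (A'.mul p.2) r a.2 c.2))
    (fun a b c => Prod.ext ((A.mul p.1 a.1).map_add b.1 c.1)
      ((A'.mul p.2 a.2).map_add b.2 c.2))
    (fun r a c => Prod.ext ((A.mul p.1 a.1).map_smul r c.1)
      ((A'.mul p.2 a.2).map_smul r c.2))
  unit p := ((A.unit p.1, A'.unit p.2) : E × E')

/-- The germ `(M, p)` is irreducible: it is not isomorphic to a product of two germs of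
F-manifolds (which have dimension at least one). -/
def TangentMul.IsIrreducibleAt (A : TangentMul I M) (p : M) : Prop :=
  ¬ ∃ (n₁ n₂ : ℕ) (M₁ M₂ : Type) (_ : TopologicalSpace M₁) (_ : TopologicalSpace M₂)
    (_ : ChartedSpace (EuclideanSpace ℂ (Fin n₁)) M₁)
    (_ : ChartedSpace (EuclideanSpace ℂ (Fin n₂)) M₂)
    (_ : IsManifold 𝓘(ℂ, EuclideanSpace ℂ (Fin n₁)) ω M₁)
    (_ : IsManifold 𝓘(ℂ, EuclideanSpace ℂ (Fin n₂)) ω M₂)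
    (A₁ : TangentMul 𝓘(ℂ, EuclideanSpace ℂ (Fin n₁)) M₁)
    (A₂ : TangentMul 𝓘(ℂ, EuclideanSpace ℂ (Fin n₂)) M₂) (p₁ : M₁) (p₂ : M₂),
    A₁.IsFManifold ∧ A₂.IsFManifold ∧ GermIso (A₁.prod A₂) (p₁, p₂) A p

end Germs

section Models

/-- The bilinear product on `ℂ²` with unit `(1, 0)` and `(0, 1) ∘ (0, 1) = (b, 0)`. -/
noncomputable def planarBilin (b : ℂ) : ℂ × ℂ →ₗ[ℂ] ℂ × ℂ →ₗ[ℂ] ℂ × ℂ :=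
  LinearMap.mk₂ ℂ
    (fun u v => (u.1 * v.1 + b * (u.2 * v.2), u.1 * v.2 + u.2 * v.1))
    (fun _ _ _ => by ext <;> simp <;> ring)
    (fun _ _ _ => by ext <;> simp <;> ring)
    (fun _ _ _ => by ext <;> simp <;> ring)
    (fun _ _ _ => by ext <;> simp <;> ring)

/-- The multiplication on `T ℂ²` with unit field `∂₁` and `∂₂ ∘ ∂₂ = β ∂₁`; tangent vectors
`u₁ ∂₁ + u₂ ∂₂` are written `(u₁, u₂)`. -/
noncomputable def planarMul (β : ℂ × ℂ → ℂ) : TangentMul 𝓘(ℂ, ℂ × ℂ) (ℂ × ℂ) where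
  mul t := planarBilin (β t)
  unit _ := ((1, 0) : ℂ × ℂ)

/-- `I₂(m)` (for `m ≥ 2`): `e = ∂₁`, `∂₂ ∘ ∂₂ = t₂^(m-2) ∂₁`. -/
noncomputable def I2 (m : ℕ) : TangentMul 𝓘(ℂ, ℂ × ℂ) (ℂ × ℂ) :=
  planarMul (fun t => t.2 ^ (m - 2))

/-- The vector field `t₁ ∂₁ + (2/m) t₂ ∂₂`. -/
noncomputable def eulerI2 (m : ℕ) : ∀ t : ℂ × ℂ, TangentSpace 𝓘(ℂ, ℂ × ℂ) t :=
  fun t => ((t.1, 2 / (m : ℂ) * t.2) : ℂ × ℂ)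

/-- The multiplication `e = ∂₁`, `∂₂ ∘ ∂₂ = 0`. -/
noncomputable def nilpotentPlane : TangentMul 𝓘(ℂ, ℂ × ℂ) (ℂ × ℂ) :=
  planarMul (fun _ => 0)

/-- `A₁²`: `e_i ∘ e_j = δ_{ij} e_i` for the coordinate fields `e₁, e₂` of `ℂ²`, and
`e = e₁ + e₂`. -/
noncomputable def A1Sq : TangentMul 𝓘(ℂ, ℂ × ℂ) (ℂ × ℂ) where
  mul _ := LinearMap.mul ℂ (ℂ × ℂ)
  unit _ := ((1, 1) : ℂ × ℂ)

end Models

end FMfd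

/-! In dimension two the structure reduces to one function of one variable. Because `e = e ∘ e`, the
F-manifold identity gives `Lie_e(∘) = 2 Lie_e(∘)`, hence `Lie_e(∘) = 0`. In coordinates with `e =
∂₁` the square `∂₂ ∘ ∂₂ = m₁ ∂₁ + m₂ ∂₂` therefore has coefficients depending on `t₂` alone
(`exists_germIso_planarMulOfSq`). Completing the square by the shear `t₁ + φ(t₂)` with `φ' = m₂/2`
leaves `∂₂ ∘ ∂₂ = f(t₂) ∂₁` (`germIso_planarMulOfSq_planarMul`).

Under `t₂ ↦ Y(t₂)` the function `f` transforms like a quadratic differential `f (dt₂)²`. If `f`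
vanishes identically near `0`, the germ is the nilpotent plane; otherwise `f = Y^k (Y')²` for a
coordinate `Y`, and the germ is `I₂(k + 2)` (`exists_coordinate_pow_mul_deriv_sq`). The exponent is
an invariant because it is the vanishing order of the differential (`I2_not_lt`).

Massiveness is global while this dichotomy is local. The two kinds of germs are told apart by the
interior of the non-semisimple locus, which is thereby clopen, and connectedness does the rest
(`isClopen_interior_not_isSemisimpleAt`).

Straightening `e` needs holomorphic solutions of `ξ X = g`. They are given by an explicit Lie
series, whose uniform limit is analytic by Cauchy's integral formula used in each variable.

The statements about the models rest on two computations. The characters of the algebra with `∂₂ ∘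
∂₂ = b ∂₁` are the square roots of `b`, which yields caustic, bifurcation diagram and discriminant.
The equation `Lie_X(∘) = d ∘` becomes a first-order linear system for `X` (`lieTensor_eq_smul_iff`),
which is solved by hand. -/

namespace FMfd

/-! ### Analyticity in two variables from separate holomorphy. -/

section SeveralComplexVariables

open Set Filter Metric

/-- A continuous separately holomorphic function on a closed polydisc is analytic at the centre. -/
theorem analyticAt_of_separately_differentiable {y : ℂ × ℂ → ℂ} {p : ℂ × ℂ} {r : ℝ} (hr : 0 < r)
    (hc : ContinuousOn y (closedBall p r))
    (h1 : ∀ b ∈ closedBall p.2 r, DifferentiableOn ℂ (fun a => y (a, b)) (ball p.1 r))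
    (h2 : ∀ a ∈ closedBall p.1 r, DifferentiableOn ℂ (fun b => y (a, b)) (ball p.2 r)) :
    AnalyticAt ℂ y p := by
  have hmem : ∀ {a b : ℂ}, a ∈ closedBall p.1 r → b ∈ closedBall p.2 r →
      (a, b) ∈ closedBall p r := by
    intro a b ha hb
    rw [← closedBall_prod_same p.1 p.2 r]
    exact ⟨ha, hb⟩
  let S := sphere p.1 r
  have hS : ∀ ζ : S, (ζ : ℂ) ∈ closedBall p.1 r := fun ζ => sphere_subset_closedBall ζ.2
  -- The map `π` is the identity on the closed disc and constant outside; it only makes `G` below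
  -- total.
  have hproj : ∀ b : ℂ, ∃ b' ∈ closedBall p.2 r, b ∈ closedBall p.2 r → b' = b := by
    intro b
    by_cases hb : b ∈ closedBall p.2 r
    · exact ⟨b, hb, fun _ => rfl⟩
    · exact ⟨p.2, mem_closedBall_self hr.le, fun h => absurd h hb⟩
  choose π hπ hπ' using hproj
  -- The function `y` becomes a one-variable function of `b` with values in the Banach algebra `C(S,
  -- ℂ)`, so that Cauchy's formula in `b` yields a power series uniform in `ζ`.
  let G : ℂ → C(S, ℂ) := fun b => ⟨fun ζ => y (ζ, π b), by
    refine hc.comp_continuous (by fun_prop) fun ζ => hmem (hS ζ) (hπ b)⟩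
  have hG : ∀ b ∈ closedBall p.2 r, ∀ ζ : S, G b ζ = y (ζ, b) := by
    intro b hb ζ
    simp only [G, ContinuousMap.coe_mk, hπ' b hb]
  have hGc : ContinuousOn G (closedBall p.2 r) := by
    rw [continuousOn_iff_continuous_domRestrict]
    refine ContinuousMap.continuous_of_continuous_uncurry _ ?_
    refine hc.comp_continuous (f := fun q : (closedBall p.2 r) × S => ((q.2 : ℂ), π q.1)) ?_
      fun q => hmem (hS q.2) (hπ _)
    have : (fun q : (closedBall p.2 r) × S => ((q.2 : ℂ), π q.1))
        = fun q => ((q.2 : ℂ), (q.1 : ℂ)) := by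
      ext q <;> simp [hπ' _ q.1.2]
    rw [this]
    fun_prop
  lift r to NNReal using hr.le
  have hr' : 0 < r := by exact_mod_cast hr
  have hGci : CircleIntegrable G p.2 r :=
    (hGc.mono sphere_subset_closedBall).circleIntegrable r.2
  have hGa := (hasFPowerSeriesOn_cauchy_integral hGci hr').analyticAt
  have hGeq : G =ᶠ[𝓝 p.2] fun b => (2 * (Real.pi : ℂ) * Complex.I)⁻¹ •
      ∮ z in C(p.2, r), (z - b)⁻¹ • G z := by
    filter_upwards [ball_mem_nhds p.2 hr] with b hb
    ext ζ
    have hint : CircleIntegrable (fun z => (z - b)⁻¹ • G z) p.2 r := by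
      refine hGci.continuousOn_smul (f := G) (g := fun z => (z - b)⁻¹) ?_
      rw [NNReal.abs_eq]
      refine ContinuousOn.inv₀ (by fun_prop) fun z hz => ?_
      rw [sub_ne_zero]
      rintro rfl
      exact (sphere_disjoint_ball.le_bot ⟨hz, hb⟩)
    have e1 : (∮ z in C(p.2, r), (z - b)⁻¹ • G z) ζ = ∮ z in C(p.2, r), (z - b)⁻¹ • G z ζ := by
      have := (ContinuousMap.evalCLM ℂ ζ).intervalIntegral_comp_comm hint.out
      simp only [circleIntegral]
      simp only [ContinuousMap.evalCLM_apply] at this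
      rw [← this]
      rfl
    rw [ContinuousMap.smul_apply, e1]
    have e2 : (∮ z in C(p.2, r), (z - b)⁻¹ • G z ζ)
        = ∮ z in C(p.2, r), (z - b)⁻¹ • y (ζ, z) :=
      circleIntegral.integral_congr r.2 fun z hz => by
        simp only [hG z (sphere_subset_closedBall hz)]
    rw [e2, hG b (ball_subset_closedBall hb)]
    have hd : DiffContOnCl ℂ (fun z => y (ζ, z)) (ball p.2 r) := by
      refine ⟨h2 ζ (hS ζ), ?_⟩
      rw [closure_ball _ hr.ne']
      exact hc.comp (by fun_prop) fun z hz => hmem (hS ζ) hz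
    exact (hd.two_pi_i_inv_smul_circleIntegral_sub_inv_smul hb).symm
  have hGan : AnalyticAt ℂ G p.2 := hGa.congr hGeq.symm
  -- the Cauchy kernel and the integration functional
  let ι : C(S, ℂ) := ⟨fun ζ => (ζ : ℂ), continuous_subtype_val⟩
  let K : ℂ → C(S, ℂ) := fun a => Ring.inverse (ι - a • 1)
  have hunit : ∀ a ∈ ball p.1 (r : ℝ), IsUnit (ι - a • (1 : C(S, ℂ))) := by
    intro a ha
    rw [ContinuousMap.isUnit_iff_forall_ne_zero]
    intro ζ
    simp only [ContinuousMap.sub_apply, ι, ContinuousMap.coe_mk, ContinuousMap.smul_apply,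
      ContinuousMap.one_apply, smul_eq_mul, mul_one, ne_eq, sub_eq_zero]
    intro h
    exact sphere_disjoint_ball.le_bot ⟨ζ.2, h ▸ ha⟩
  -- Inversion in a Banach algebra is analytic at units, so the Cauchy kernel is analytic in `a` as
  -- a `C(S, ℂ)`-valued map.
  have hK : AnalyticAt ℂ K p.1 := by
    obtain ⟨u, hu⟩ := hunit p.1 (mem_ball_self hr)
    have h := analyticAt_inverse (𝕜 := ℂ) u
    rw [hu] at h
    exact h.comp (f := fun a => ι - a • (1 : C(S, ℂ)))
      (analyticAt_const.sub (analyticAt_id.smul analyticAt_const))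
  have hKv : ∀ a ∈ ball p.1 (r : ℝ), ∀ ζ : S, K a ζ = ((ζ : ℂ) - a)⁻¹ := by
    intro a ha ζ
    have h := Ring.inverse_mul_cancel _ (hunit a ha)
    have h2 := congrArg (fun f : C(S, ℂ) => f ζ) h
    simp only [ContinuousMap.mul_apply, ContinuousMap.sub_apply, ι, ContinuousMap.coe_mk,
      ContinuousMap.smul_apply, smul_eq_mul, mul_one, ContinuousMap.one_apply] at h2
    exact eq_inv_of_mul_eq_one_left h2
  let c : ℝ → S := fun θ => ⟨circleMap p.1 r θ, circleMap_mem_sphere _ r.2 _⟩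
  have hcc : Continuous c := (continuous_circleMap _ _).subtype_mk _
  have hcd : Continuous fun θ => deriv (circleMap p.1 (r : ℝ)) θ := by
    simp only [deriv_circleMap]
    fun_prop
  have hint : ∀ f : C(S, ℂ), IntervalIntegrable
      (fun θ => deriv (circleMap p.1 (r : ℝ)) θ • f (c θ)) MeasureTheory.volume 0 (2 * Real.pi) :=
    fun f => (hcd.smul (f.continuous.comp hcc)).intervalIntegrable _ _
  let Λ : C(S, ℂ) →L[ℂ] ℂ := LinearMap.mkContinuous
    { toFun := fun f => ∫ θ in (0 : ℝ)..2 * Real.pi, deriv (circleMap p.1 (r : ℝ)) θ • f (c θ)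
      map_add' := fun f g => by
        rw [← intervalIntegral.integral_add (hint f) (hint g)]
        simp only [ContinuousMap.add_apply, smul_add]
      map_smul' := fun k f => by
        rw [RingHom.id_apply, ← intervalIntegral.integral_smul]
        simp only [ContinuousMap.smul_apply, smul_comm k] } (r * |2 * Real.pi - 0|) (by
      intro f
      have h := intervalIntegral.norm_integral_le_of_norm_le_const (a := 0) (b := 2 * Real.pi)
        (f := fun θ => deriv (circleMap p.1 (r : ℝ)) θ • f (c θ)) (C := r * ‖f‖) (by
          intro θ _
          rw [norm_smul]
          refine mul_le_mul ?_ (f.norm_coe_le_norm _) (norm_nonneg _) r.2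
          simp)
      refine h.trans (le_of_eq ?_)
      ring)
  -- Cauchy's formula in the first variable writes `y (a, b)` as a continuous linear functional of a
  -- product of a map of `a` and a map of `b`, both analytic.
  have hy : y =ᶠ[𝓝 p] fun z => (2 * (Real.pi : ℂ) * Complex.I)⁻¹ • Λ (K z.1 * G z.2) := by
    filter_upwards [ball_mem_nhds p hr] with z hz
    rw [← ball_prod_same] at hz
    have hd : DiffContOnCl ℂ (fun a => y (a, z.2)) (ball p.1 r) := by
      refine ⟨h1 z.2 (ball_subset_closedBall hz.2), ?_⟩
      rw [closure_ball _ hr.ne']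
      exact hc.comp (by fun_prop) fun a ha => hmem ha (ball_subset_closedBall hz.2)
    have h := hd.two_pi_i_inv_smul_circleIntegral_sub_inv_smul hz.1
    refine h.symm.trans ?_
    congr 1
    refine intervalIntegral.integral_congr fun θ _ => ?_
    simp only [ContinuousMap.mul_apply, hKv z.1 hz.1, hG z.2 (ball_subset_closedBall hz.2), c,
      smul_eq_mul]
  refine AnalyticAt.congr ?_ hy.symm
  have hK' : AnalyticAt ℂ (fun z : ℂ × ℂ => K z.1) p := hK.comp analyticAt_fst
  have hG' : AnalyticAt ℂ (fun z : ℂ × ℂ => G z.2) p := hGan.comp analyticAt_snd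
  have hΛ : AnalyticAt ℂ (fun z : ℂ × ℂ => Λ (K z.1 * G z.2)) p :=
    (Λ.analyticAt _).comp (hK'.mul hG')
  exact analyticAt_const.fun_smul hΛ

/-- A uniform limit of analytic functions of two variables is analytic. -/
theorem analyticAt_of_tendstoUniformlyOn {S : ℕ → ℂ × ℂ → ℂ} {y : ℂ × ℂ → ℂ} {U : Set (ℂ × ℂ)}
    (hU : IsOpen U) (hS : ∀ n, AnalyticOnNhd ℂ (S n) U) (h : TendstoUniformlyOn S y atTop U)
    {p : ℂ × ℂ} (hp : p ∈ U) : AnalyticAt ℂ y p := by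
  obtain ⟨r, hr, hrU⟩ := nhds_basis_closedBall.mem_iff.1 (hU.mem_nhds hp)
  have hyc : ContinuousOn y U :=
    h.continuousOn (Frequently.of_forall fun n => (hS n).continuousOn)
  have hmem : ∀ {a b : ℂ}, a ∈ closedBall p.1 r → b ∈ closedBall p.2 r → (a, b) ∈ U := by
    intro a b ha hb
    refine hrU ?_
    rw [← closedBall_prod_same p.1 p.2 r]
    exact ⟨ha, hb⟩
  refine analyticAt_of_separately_differentiable hr (hyc.mono hrU) ?_ ?_
  · intro b hb
    have := (h.comp fun a : ℂ => (a, b)).mono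
      (s' := ball p.1 r) fun a ha => hmem (ball_subset_closedBall ha) hb
    refine this.tendstoLocallyUniformlyOn.differentiableOn (Eventually.of_forall fun n => ?_)
      isOpen_ball
    exact (hS n).differentiableOn.comp (by fun_prop) fun a ha =>
      hmem (ball_subset_closedBall ha) hb
  · intro a ha
    have := (h.comp fun b : ℂ => (a, b)).mono
      (s' := ball p.2 r) fun b hb => hmem ha (ball_subset_closedBall hb)
    refine this.tendstoLocallyUniformlyOn.differentiableOn (Eventually.of_forall fun n => ?_)
      isOpen_ball
    exact (hS n).differentiableOn.comp (by fun_prop) fun b hb =>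
      hmem ha (ball_subset_closedBall hb)

end SeveralComplexVariables
-- Solving `ξ X = g` by a Lie series.
section LieSeries

open Set Filter Metric

variable {V : Type*} [NormedAddCommGroup V] [NormedSpace ℂ V]

/-- The derivative of a function along a vector field. -/
noncomputable def derivAlong (ξ : V → V) (w : V → ℂ) : V → ℂ := fun z => fderiv ℂ w z (ξ z)

theorem analyticOnNhd_derivAlong [CompleteSpace V] {ξ : V → V} {w : V → ℂ} {U : Set V}
    (hξ : AnalyticOnNhd ℂ ξ U) (hw : AnalyticOnNhd ℂ w U) :
    AnalyticOnNhd ℂ (derivAlong ξ w) U :=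
  fun z hz => ((AnalyticAt.fderiv (hw z hz)).contDiffAt.clm_apply
    ((hξ z hz).contDiffAt (n := ω))).analyticAt

theorem analyticOnNhd_iterate_derivAlong [CompleteSpace V] {ξ : V → V} {w : V → ℂ} {U : Set V}
    (hξ : AnalyticOnNhd ℂ ξ U) (hw : AnalyticOnNhd ℂ w U) (n : ℕ) :
    AnalyticOnNhd ℂ ((derivAlong ξ)^[n] w) U := by
  induction n with
  | zero => exact hw
  | succ n ih =>
    rw [Function.iterate_succ_apply']
    exact analyticOnNhd_derivAlong hξ ih

/-- Cauchy's estimate for the derivative along a vector. -/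
theorem norm_derivAlong_le {ξ : V → V} {w : V → ℂ} {p : V} {r δ C B : ℝ} (hδ : 0 < δ) (hC : 0 < C)
    (hw : DifferentiableOn ℂ w (ball p (r + δ))) (hB : ∀ z ∈ ball p (r + δ), ‖w z‖ ≤ B)
    {z : V} (hz : z ∈ ball p r) (hξ : ‖ξ z‖ ≤ C) : ‖derivAlong ξ w z‖ ≤ B * (C / δ) := by
  have hmaps : ∀ s ∈ closedBall (0 : ℂ) (δ / C), z + s • ξ z ∈ ball p (r + δ) := by
    intro s hs
    rw [mem_ball, dist_eq_norm] at hz ⊢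
    rw [mem_closedBall, dist_zero_right] at hs
    calc ‖z + s • ξ z - p‖ = ‖(z - p) + s • ξ z‖ := by congr 1; abel
      _ ≤ ‖z - p‖ + ‖s‖ * ‖ξ z‖ := (norm_add_le _ _).trans (by rw [norm_smul])
      _ ≤ ‖z - p‖ + δ / C * C := by gcongr
      _ < r + δ := by rw [div_mul_cancel₀ _ hC.ne']; linarith
  have hd : DiffContOnCl ℂ (fun s : ℂ => w (z + s • ξ z)) (ball 0 (δ / C)) := by
    refine DifferentiableOn.diffContOnCl ?_
    rw [closure_ball _ (div_pos hδ hC).ne']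
    exact hw.comp (by fun_prop) hmaps
  have h := Complex.norm_deriv_le_of_forall_mem_sphere_norm_le (div_pos hδ hC) hd
    fun s hs => hB _ (hmaps s (sphere_subset_closedBall hs))
  have hwz : HasFDerivAt w (fderiv ℂ w z) (z + (0 : ℂ) • ξ z) := by
    have hz0 := hmaps 0 (mem_closedBall_self (div_pos hδ hC).le)
    rw [zero_smul, add_zero] at hz0 ⊢
    exact (hw.differentiableAt (isOpen_ball.mem_nhds hz0)).hasFDerivAt
  have hline : HasDerivAt (fun s : ℂ => z + s • ξ z) (ξ z) 0 := by
    simpa using ((hasDerivAt_id (0 : ℂ)).smul_const (ξ z)).const_add z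
  have h0 : deriv (fun s : ℂ => w (z + s • ξ z)) 0 = derivAlong ξ w z :=
    (hwz.comp_hasDerivAt (0 : ℂ) hline).deriv
  rw [h0] at h
  refine h.trans (le_of_eq ?_)
  field_simp

/-- The way from radius `R` down to `R / 2` is cut into `n` steps of width `δ = R / (2n)`, and
Cauchy's estimate costs a factor `C / δ = 2Cn / R` at each step. The growth `n ^ n` is absorbed by
the factorials of the Lie series. -/
theorem norm_iterate_derivAlong_le [CompleteSpace V] {ξ : V → V} {w : V → ℂ} {p : V} {R C B : ℝ}
    (hR : 0 < R)
    (hC : 0 < C) (hξa : AnalyticOnNhd ℂ ξ (ball p R)) (hξ : ∀ z ∈ ball p R, ‖ξ z‖ ≤ C)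
    (hw : AnalyticOnNhd ℂ w (ball p R)) (hB : ∀ z ∈ ball p R, ‖w z‖ ≤ B) (n : ℕ) {z : V}
    (hz : z ∈ ball p (R / 2)) :
    ‖(derivAlong ξ)^[n] w z‖ ≤ B * (2 * C / R * n) ^ n := by
  rcases Nat.eq_zero_or_pos n with rfl | hn
  · simpa using hB z (ball_subset_ball (by linarith) hz)
  have hn' : (0 : ℝ) < n := by exact_mod_cast hn
  set δ := R / (2 * n) with hδdef
  have hδ : 0 < δ := by positivity
  have hnδ : n * δ = R / 2 := by rw [hδdef]; field_simp
  have key : ∀ k ≤ n, ∀ z ∈ ball p (R / 2 + (n - k) * δ),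
      ‖(derivAlong ξ)^[k] w z‖ ≤ B * (C / δ) ^ k := by
    intro k
    induction k with
    | zero =>
      intro _ z hz
      have : R / 2 + (n - (0 : ℕ)) * δ = R := by push_cast; linarith
      rw [this] at hz
      simpa using hB z hz
    | succ k ih =>
      intro hk z hz
      have hk' : ((k : ℝ) + 1) ≤ n := by exact_mod_cast hk
      have hsub : ball p (R / 2 + (n - (k + 1 : ℕ)) * δ + δ) ⊆ ball p R := by
        refine ball_subset_ball ?_
        push_cast
        nlinarith [Nat.cast_nonneg (α := ℝ) k]
      rw [Function.iterate_succ_apply']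
      have hB' : ∀ z ∈ ball p (R / 2 + (n - (k + 1 : ℕ)) * δ + δ),
          ‖(derivAlong ξ)^[k] w z‖ ≤ B * (C / δ) ^ k := by
        intro z hz
        refine ih (by omega) z ?_
        convert hz using 1
        push_cast
        ring_nf
      have := norm_derivAlong_le hδ hC
        ((analyticOnNhd_iterate_derivAlong hξa hw k).mono hsub).differentiableOn hB' hz
        (hξ z (hsub (ball_subset_ball (by linarith) hz)))
      rw [pow_succ, ← mul_assoc]
      exact this
  have h := key n le_rfl z (by simpa using hz)
  convert h using 3
  rw [hδdef]
  field_simp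

theorem hasDerivAt_line {w : V → ℂ} {z : V} (hw : DifferentiableAt ℂ w z) (v : V) :
    HasDerivAt (fun s : ℂ => w (z + s • v)) (fderiv ℂ w z v) 0 := by
  have hline : HasDerivAt (fun s : ℂ => z + s • v) v 0 := by
    simpa using ((hasDerivAt_id (0 : ℂ)).smul_const v).const_add z
  have hwz : HasFDerivAt w (fderiv ℂ w z) (z + (0 : ℂ) • v) := by
    rw [zero_smul, add_zero]
    exact hw.hasFDerivAt
  exact hwz.comp_hasDerivAt (0 : ℂ) hline

/-- Partial sums of the Lie series solving `ξ X = g`, `X = 0` on `ℓ = 0`. -/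
noncomputable def lieTerm (ξ : V → V) (ℓ g : V → ℂ) (n : ℕ) : V → ℂ :=
  fun z => (-1) ^ n * (ℓ z ^ (n + 1) / (n + 1).factorial) * (derivAlong ξ)^[n] g z

/-- Since `ξ ℓ = 1`, the product rule gives a difference `a n - a (n + 1)`, where `a n = (-1)^n ℓ^n
/ n! · ξ^n g`. The partial sums thus telescope to `g - a N`. -/
theorem derivAlong_lieTerm [CompleteSpace V] {ξ : V → V} {ℓ g : V → ℂ} {U : Set V}
    (hξ : AnalyticOnNhd ℂ ξ U) (hg : AnalyticOnNhd ℂ g U) (hℓ : Differentiable ℂ ℓ)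
    (hℓ1 : ∀ z ∈ U, derivAlong ξ ℓ z = 1) (n : ℕ) {z : V} (hz : z ∈ U) :
    derivAlong ξ (lieTerm ξ ℓ g n) z =
      (-1) ^ n * (ℓ z ^ n / n.factorial) * (derivAlong ξ)^[n] g z
      - (-1) ^ (n + 1) * (ℓ z ^ (n + 1) / (n + 1).factorial) * (derivAlong ξ)^[n + 1] g z := by
  have h1 := (hℓ z).hasFDerivAt
  have h2 := (analyticOnNhd_iterate_derivAlong hξ hg n z hz).differentiableAt.hasFDerivAt
  have h3 := (((h1.pow (n + 1)).mul_const ((n + 1).factorial : ℂ)⁻¹).const_mul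
    ((-1 : ℂ) ^ n)).mul h2
  have h4 : fderiv ℂ ℓ z (ξ z) = 1 := hℓ1 z hz
  have h5 : lieTerm ξ ℓ g n = (fun y => (-1) ^ n * (ℓ y ^ (n + 1) * ((n + 1).factorial : ℂ)⁻¹))
      * (derivAlong ξ)^[n] g := rfl
  have hf : ((n.factorial : ℕ) : ℂ) ≠ 0 := by exact_mod_cast n.factorial_ne_zero
  have hn1 : (n : ℂ) + 1 ≠ 0 := by exact_mod_cast n.succ_ne_zero
  rw [derivAlong, h5, h3.fderiv, Function.iterate_succ_apply']
  simp only [add_apply, smul_apply, h4, smul_eq_mul,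
    Nat.factorial_succ, Nat.cast_mul, Nat.cast_succ, derivAlong, add_tsub_cancel_right,
    nsmul_eq_mul]
  field_simp
  ring

/-- The equation `ξ X = g` has a holomorphic solution `X` that vanishes on a hyperplane transversal
to the vector field `ξ`. -/
theorem exists_derivAlong_eq {p : ℂ × ℂ} {ξ : ℂ × ℂ → ℂ × ℂ} {g : ℂ × ℂ → ℂ}
    (hξ : AnalyticAt ℂ ξ p) (hg : AnalyticAt ℂ g p) (lam : ℂ × ℂ →L[ℂ] ℂ)
    (hl : ∀ᶠ z in 𝓝 p, lam (ξ z) = 1) :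
    ∃ X : ℂ × ℂ → ℂ, AnalyticAt ℂ X p ∧ (∀ᶠ z in 𝓝 p, derivAlong ξ X z = g z) ∧
      X p = 0 ∧ ∀ v, lam v = 0 → fderiv ℂ X p v = 0 := by
  obtain ⟨R, hR, hball⟩ : ∃ R > 0, ∀ z ∈ ball p R, AnalyticAt ℂ ξ z ∧ AnalyticAt ℂ g z ∧
      lam (ξ z) = 1 ∧ ‖ξ z‖ < ‖ξ p‖ + 1 ∧ ‖g z‖ < ‖g p‖ + 1 := by
    have := (((hξ.eventually_analyticAt.and hg.eventually_analyticAt).and hl).and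
      (hξ.continuousAt.norm.eventually_lt_const (lt_add_one _))).and
      (hg.continuousAt.norm.eventually_lt_const (lt_add_one _))
    obtain ⟨R, hR, h⟩ := Metric.eventually_nhds_iff_ball.1 this
    exact ⟨R, hR, fun z hz => by
      obtain ⟨⟨⟨⟨h1, h2⟩, h3⟩, h4⟩, h5⟩ := h z hz
      exact ⟨h1, h2, h3, h4, h5⟩⟩
  set C := ‖ξ p‖ + 1 with hCdef
  set B := ‖g p‖ + 1 with hBdef
  have hC : 0 < C := by positivity
  have hB : 0 < B := by positivity
  have hξa : AnalyticOnNhd ℂ ξ (ball p R) := fun z hz => (hball z hz).1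
  have hga : AnalyticOnNhd ℂ g (ball p R) := fun z hz => (hball z hz).2.1
  let ℓ : ℂ × ℂ → ℂ := fun z => lam (z - p)
  have hℓ : Differentiable ℂ ℓ := by fun_prop
  have hℓ1 : ∀ z ∈ ball p R, derivAlong ξ ℓ z = 1 := by
    intro z hz
    have : HasFDerivAt ℓ lam z := lam.hasFDerivAt.comp z (hasFDerivAt_sub_const p)
    rw [derivAlong, this.fderiv, (hball z hz).2.2.1]
  -- On this ball `‖ℓ‖ ≤ R / (4Ce)`; with `n ^ n / n! ≤ e ^ n` this bounds `a n` by `B / 2 ^ n`.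
  set ε := min (R / 2) (R / (4 * C * Real.exp 1 * (‖lam‖ + 1))) with hε
  have he := Real.exp_pos 1
  have hε0 : 0 < ε := by positivity
  have hεR : ε ≤ R / 2 := min_le_left _ _
  have hsub : ball p ε ⊆ ball p (R / 2) := ball_subset_ball hεR
  have hsub' : ball p ε ⊆ ball p R := ball_subset_ball (by linarith)
  have hℓb : ∀ z ∈ ball p ε, ‖ℓ z‖ ≤ R / (4 * C * Real.exp 1) := by
    intro z hz
    rw [mem_ball, dist_eq_norm] at hz
    calc ‖ℓ z‖ ≤ ‖lam‖ * ‖z - p‖ := lam.le_opNorm _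
      _ ≤ (‖lam‖ + 1) * (R / (4 * C * Real.exp 1 * (‖lam‖ + 1))) := by
        gcongr
        · linarith
        · exact hz.le.trans (min_le_right _ _)
      _ = _ := by field_simp
  have hu : ∀ n : ℕ, ∀ z ∈ ball p ε,
      ‖(-1 : ℂ) ^ n * (ℓ z ^ n / n.factorial) * (derivAlong ξ)^[n] g z‖ ≤ B * (1 / 2) ^ n := by
    intro n z hz
    have h1 := norm_iterate_derivAlong_le hR hC hξa (fun z hz => (hball z hz).2.2.2.1.le) hga
      (fun z hz => (hball z hz).2.2.2.2.le) n (hsub hz)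
    have h2 : (n : ℝ) ^ n / n.factorial ≤ Real.exp 1 ^ n := by
      rw [← Real.exp_nat_mul, mul_one]
      exact Real.pow_div_factorial_le_exp _ (Nat.cast_nonneg n) n
    rw [norm_mul, norm_mul, norm_pow, norm_neg, norm_one, one_pow, one_mul, norm_div, norm_pow,
      Complex.norm_natCast]
    calc ‖ℓ z‖ ^ n / n.factorial * ‖(derivAlong ξ)^[n] g z‖
        ≤ (R / (4 * C * Real.exp 1)) ^ n / n.factorial * (B * (2 * C / R * n) ^ n) := by
          gcongr
          exact hℓb z hz
      _ = B * ((1 / (2 * Real.exp 1)) ^ n * ((n : ℝ) ^ n / n.factorial)) := by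
          have : R / (4 * C * Real.exp 1) = (1 / (2 * Real.exp 1)) * (R / (2 * C)) := by
            field_simp
            norm_num
          rw [this, mul_pow, mul_pow (2 * C / R)]
          have h3 : (R / (2 * C)) ^ n * (2 * C / R) ^ n = 1 := by
            rw [← mul_pow]
            have : R / (2 * C) * (2 * C / R) = 1 := by field_simp
            rw [this, one_pow]
          linear_combination (B * (1 / (2 * Real.exp 1)) ^ n * (n : ℝ) ^ n / n.factorial) * h3
      _ ≤ B * ((1 / (2 * Real.exp 1)) ^ n * Real.exp 1 ^ n) := by gcongr
      _ = B * (1 / 2) ^ n := by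
          rw [← mul_pow]
          congr 2
          field_simp
  have hT : ∀ n : ℕ, ∀ z ∈ ball p ε,
      ‖lieTerm ξ ℓ g n z‖ ≤ R / (4 * C * Real.exp 1) * B * (1 / 2) ^ n := by
    intro n z hz
    have h1 : lieTerm ξ ℓ g n z = ℓ z / (n + 1) *
        ((-1 : ℂ) ^ n * (ℓ z ^ n / n.factorial) * (derivAlong ξ)^[n] g z) := by
      rw [lieTerm, Nat.factorial_succ]
      push_cast
      have hf : ((n.factorial : ℕ) : ℂ) ≠ 0 := by exact_mod_cast n.factorial_ne_zero
      have hn1 : (n : ℂ) + 1 ≠ 0 := by exact_mod_cast n.succ_ne_zero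
      field_simp
      ring
    have h2 : ‖ℓ z / (n + 1)‖ ≤ R / (4 * C * Real.exp 1) := by
      have : ‖(n : ℂ) + 1‖ = n + 1 := by
        rw [← Nat.cast_succ, Complex.norm_natCast]
        push_cast
        rfl
      rw [norm_div, this]
      refine (div_le_self (norm_nonneg _) ?_).trans (hℓb z hz)
      linarith [Nat.cast_nonneg (α := ℝ) n]
    rw [h1, norm_mul, mul_assoc (R / (4 * C * Real.exp 1))]
    exact mul_le_mul h2 (hu n z hz) (norm_nonneg _) (by positivity)
  let X : ℂ × ℂ → ℂ := fun z => ∑' n, lieTerm ξ ℓ g n z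
  let S : ℕ → ℂ × ℂ → ℂ := fun N z => ∑ n ∈ Finset.range N, lieTerm ξ ℓ g n z
  have hlim : TendstoUniformlyOn S X atTop (ball p ε) :=
    tendstoUniformlyOn_tsum_nat ((summable_geometric_of_lt_one (by norm_num)
      (by norm_num : (1 / 2 : ℝ) < 1)).mul_left _) hT
  have hTa : ∀ n, AnalyticOnNhd ℂ (lieTerm ξ ℓ g n) (ball p ε) := by
    intro n z hz
    have h1 : AnalyticAt ℂ ℓ z := (lam.analyticAt _).comp (analyticAt_id.sub analyticAt_const)
    have h2 := analyticOnNhd_iterate_derivAlong hξa hga n z (hsub' hz)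
    exact (analyticAt_const.mul ((h1.pow _).mul analyticAt_const)).mul h2
  have hSa : ∀ N, AnalyticOnNhd ℂ (S N) (ball p ε) := fun N z hz =>
    Finset.analyticAt_fun_sum _ fun n _ => hTa n z hz
  have hXa : ∀ z ∈ ball p ε, AnalyticAt ℂ X z := fun z hz =>
    analyticAt_of_tendstoUniformlyOn isOpen_ball hSa hlim hz
  have hDS : ∀ N, ∀ z ∈ ball p ε, derivAlong ξ (S N) z = g z
      - (-1 : ℂ) ^ N * (ℓ z ^ N / N.factorial) * (derivAlong ξ)^[N] g z := by
    intro N z hz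
    have h1 : derivAlong ξ (S N) z = ∑ n ∈ Finset.range N, derivAlong ξ (lieTerm ξ ℓ g n) z := by
      have : HasFDerivAt (S N) (∑ n ∈ Finset.range N, fderiv ℂ (lieTerm ξ ℓ g n) z) z :=
        HasFDerivAt.fun_sum fun n _ => (hTa n z hz).differentiableAt.hasFDerivAt
      rw [derivAlong, this.fderiv, sum_apply]
      rfl
    rw [h1, Finset.sum_congr rfl fun n _ => derivAlong_lieTerm hξa hga hℓ hℓ1 n (hsub' hz),
      Finset.sum_range_sub']
    simp
  refine ⟨X, hXa p (mem_ball_self hε0), ?_, ?_, ?_⟩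
  · filter_upwards [ball_mem_nhds p hε0] with z hz
    -- The derivative along `ξ z` is a one-variable derivative on the complex line through `z`, so
    -- Weierstrass's theorem allows passing to the limit.
    have hopen : IsOpen ((fun s : ℂ => z + s • ξ z) ⁻¹' ball p ε) :=
      isOpen_ball.preimage (by fun_prop)
    have h1 : TendstoUniformlyOn (fun N s => S N (z + s • ξ z)) (fun s : ℂ => X (z + s • ξ z))
        atTop ((fun s : ℂ => z + s • ξ z) ⁻¹' ball p ε) := hlim.comp _
    have h2 := h1.tendstoLocallyUniformlyOn.deriv (Eventually.of_forall fun N =>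
      (hSa N).differentiableOn.comp (by fun_prop) fun s hs => hs) hopen
    have h0 : (0 : ℂ) ∈ (fun s : ℂ => z + s • ξ z) ⁻¹' ball p ε := by simpa using hz
    have h3 := h2.tendsto_at h0
    rw [(hasDerivAt_line (hXa z hz).differentiableAt (ξ z)).deriv] at h3
    refine tendsto_nhds_unique h3 ?_
    have h4 : Tendsto (fun N : ℕ => g z
        - (-1 : ℂ) ^ N * (ℓ z ^ N / N.factorial) * (derivAlong ξ)^[N] g z) atTop (𝓝 (g z - 0)) := by
      refine tendsto_const_nhds.sub (squeeze_zero_norm (fun N => hu N z hz) ?_)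
      simpa using (tendsto_pow_atTop_nhds_zero_of_lt_one (by norm_num)
        (by norm_num : (1 / 2 : ℝ) < 1)).const_mul B
    rw [sub_zero] at h4
    refine h4.congr fun N => ?_
    rw [← hDS N z hz]
    exact (hasDerivAt_line (hSa N z hz).differentiableAt (ξ z)).deriv.symm
  · simp [X, lieTerm, ℓ]
  -- Every term contains a positive power of `ℓ`, which vanishes on the line `p + ker lam`.
  · intro v hv
    have h1 := hasDerivAt_line (hXa p (mem_ball_self hε0)).differentiableAt v
    have h2 : (fun s : ℂ => X (p + s • v)) = fun _ => 0 := by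
      ext s
      simp [X, lieTerm, ℓ, hv]
    rw [h2] at h1
    exact h1.unique (hasDerivAt_const _ _)

end LieSeries
-- Inverse function theorem and straightening of a vector field.
section LocalBiholomorphisms

open Set Filter

/-- The inverse function theorem for holomorphic maps of the plane. -/
theorem exists_openPartialHomeomorph {Φ : ℂ × ℂ → ℂ × ℂ} {p : ℂ × ℂ} (h : AnalyticAt ℂ Φ p)
    (hinj : ∀ v, fderiv ℂ Φ p v = 0 → v = 0) {W : Set (ℂ × ℂ)} (hW : W ∈ 𝓝 p) :
    ∃ Θ : OpenPartialHomeomorph (ℂ × ℂ) (ℂ × ℂ), p ∈ Θ.source ∧ ⇑Θ = Φ ∧ Θ.source ⊆ W ∧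
      ContDiffOn ℂ ω Θ Θ.source ∧ ContDiffOn ℂ ω Θ.symm Θ.target := by
  have hker : Function.Injective ((fderiv ℂ Φ p : ℂ × ℂ →L[ℂ] ℂ × ℂ) : ℂ × ℂ →ₗ[ℂ] ℂ × ℂ) :=
    (injective_iff_map_eq_zero _).2 hinj
  let L : (ℂ × ℂ) ≃L[ℂ] ℂ × ℂ := (LinearEquiv.ofInjectiveEndo _ hker).toContinuousLinearEquiv
  have hL : (L : ℂ × ℂ →L[ℂ] ℂ × ℂ) = fderiv ℂ Φ p := by
    ext <;> rfl
  have hΦ : ContDiffAt ℂ ω Φ p := h.contDiffAt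
  have hd : HasFDerivAt Φ (L : ℂ × ℂ →L[ℂ] ℂ × ℂ) p := by
    rw [hL]
    exact h.differentiableAt.hasFDerivAt
  let Θ := hΦ.toOpenPartialHomeomorph Φ hd (by simp)
  have hp : p ∈ Θ.source := hΦ.mem_toOpenPartialHomeomorph_source hd (by simp)
  have hsymm : ContDiffAt ℂ ω Θ.symm (Φ p) := hΦ.to_localInverse hd (by simp)
  -- The source is cut down to where both the map and its inverse are analytic, and to the interior
  -- of `W`.
  refine ⟨(Θ.restrContDiff ℂ ω (by simp)).restr (interior W), ?_, rfl, ?_, ?_, ?_⟩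
  · simp only [OpenPartialHomeomorph.restr_source, interior_interior]
    exact ⟨⟨hp, hΦ, hsymm⟩, mem_interior_iff_mem_nhds.2 hW⟩
  · intro q hq
    simp only [OpenPartialHomeomorph.restr_source, interior_interior] at hq
    exact interior_subset hq.2
  · refine (Θ.contDiffOn_restrContDiff_source ℂ (n := ω) (by simp)).mono ?_
    intro q hq
    simp only [OpenPartialHomeomorph.restr_source, interior_interior] at hq
    exact hq.1
  · refine (Θ.contDiffOn_restrContDiff_target ℂ (n := ω) (by simp)).mono ?_
    intro q hq
    exact hq.1

/-- A holomorphic vector field `e` of the plane that does not vanish at `p` is the first coordinate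
field of suitable coordinates. -/
theorem exists_straightening {e : ℂ × ℂ → ℂ × ℂ} {p : ℂ × ℂ} (he : AnalyticAt ℂ e p)
    (hep : e p ≠ 0) : ∃ Φ : ℂ × ℂ → ℂ × ℂ, AnalyticAt ℂ Φ p ∧ Φ p = 0 ∧
      (∀ v, fderiv ℂ Φ p v = 0 → v = 0) ∧ ∀ᶠ z in 𝓝 p, fderiv ℂ Φ z (e z) = (1, 0) := by
  obtain ⟨lam, mu, hlam, hker⟩ : ∃ lam mu : ℂ × ℂ →L[ℂ] ℂ, lam (e p) ≠ 0 ∧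
      ∀ v, lam v = 0 → mu v = 0 → v = 0 := by
    by_cases h : (e p).1 = 0
    · refine ⟨ContinuousLinearMap.snd ℂ ℂ ℂ, ContinuousLinearMap.fst ℂ ℂ ℂ, ?_, ?_⟩
      · exact fun h2 => hep (Prod.ext h h2)
      · exact fun v h1 h2 => Prod.ext h2 h1
    · exact ⟨ContinuousLinearMap.fst ℂ ℂ ℂ, ContinuousLinearMap.snd ℂ ℂ ℂ, h,
        fun v h1 h2 => Prod.ext h1 h2⟩
  have hc : AnalyticAt ℂ (fun z => lam (e z)) p := (lam.analyticAt _).comp he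
  have hne : ∀ᶠ z in 𝓝 p, lam (e z) ≠ 0 := hc.continuousAt.eventually_ne hlam
  have hci : AnalyticAt ℂ (fun z => (lam (e z))⁻¹) p := hc.inv hlam
  -- Rescaling `e` achieves `lam ξ = 1`. Then `ξ x = 1 / lam(e)` means `e x = 1`, and `ξ y = mu(ξ)`
  -- means that `mu - y` is constant along `e`; these give the two new coordinates.
  have hξ : AnalyticAt ℂ (fun z => (lam (e z))⁻¹ • e z) p := hci.smul he
  have hlξ : ∀ᶠ z in 𝓝 p, lam ((lam (e z))⁻¹ • e z) = 1 := by
    filter_upwards [hne] with z hz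
    rw [map_smul, smul_eq_mul, inv_mul_cancel₀ hz]
  have hμ : AnalyticAt ℂ (fun z => mu ((lam (e z))⁻¹ • e z)) p := (mu.analyticAt _).comp hξ
  obtain ⟨x, hxa, hx, hxp, hxv⟩ := exists_derivAlong_eq hξ hci lam hlξ
  obtain ⟨y, hya, hy, hyp, hyv⟩ := exists_derivAlong_eq hξ hμ lam hlξ
  have hμa : AnalyticAt ℂ (fun z => mu (z - p)) p :=
    (mu.analyticAt _).comp (analyticAt_id.sub analyticAt_const)
  have hder : ∀ z, AnalyticAt ℂ x z → AnalyticAt ℂ y z → ∀ v,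
      fderiv ℂ (fun z => (x z, mu (z - p) - y z)) z v = (fderiv ℂ x z v, mu v - fderiv ℂ y z v) :=
          by
    intro z h1 h2 v
    have h3 : HasFDerivAt (fun z => mu (z - p)) mu z :=
      mu.hasFDerivAt.comp z (hasFDerivAt_sub_const p)
    rw [(h1.differentiableAt.hasFDerivAt.prodMk
      (h3.fun_sub h2.differentiableAt.hasFDerivAt)).fderiv]
    rfl
  have hE : ∀ᶠ z in 𝓝 p, fderiv ℂ (fun z => (x z, mu (z - p) - y z)) z (e z) = (1, 0) := by
    filter_upwards [hne, hx, hy, hxa.eventually_analyticAt, hya.eventually_analyticAt]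
      with z h0 h1 h2 h3 h4
    rw [hder z h3 h4]
    simp only [derivAlong, map_smul, smul_eq_mul] at h1 h2
    have h1' := mul_left_cancel₀ (inv_ne_zero h0) (h1.trans (mul_one _).symm)
    have h2' := mul_left_cancel₀ (inv_ne_zero h0) h2
    rw [h1', h2', sub_self]
  refine ⟨fun z => (x z, mu (z - p) - y z), hxa.prod (hμa.sub hya), ?_, ?_, hE⟩
  · simp [hxp, hyp]
  · intro v hv
    have hEp := hE.self_of_nhds
    set D := fderiv ℂ (fun z => (x z, mu (z - p) - y z)) p with hD
    -- The projection of `v` to `ker lam` along `e p`. Its image under `D` lies in both coordinate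
    -- axes, as `x` and `y` have zero derivative on `ker lam` while `D` kills `v` and maps `e p` to
    -- `(1, 0)`.
    set w := v - (lam v / lam (e p)) • e p with hw
    have hlw : lam w = 0 := by
      rw [hw, map_sub, map_smul, smul_eq_mul, div_mul_cancel₀ _ hlam, sub_self]
    have hDw : D w = (0, mu w) := by
      rw [hD, hder p hxa hya, hxv w hlw, hyv w hlw, sub_zero]
    have hDw' : D w = (-(lam v / lam (e p)), 0) := by
      rw [hw, map_sub, map_smul, hv, hEp]
      ext <;> simp
    rw [hDw] at hDw'
    obtain ⟨h1, h2⟩ := Prod.mk.inj hDw'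
    have h3 : w = 0 := hker w hlw h2
    rw [hw, neg_eq_zero.1 h1.symm, zero_smul, sub_zero] at h3
    exact h3

end LocalBiholomorphisms

/-! ### Germ isomorphisms form an equivalence; a criterion in the plane. -/

section GermIsomorphisms

open Set Filter

universe u v w u' v' w' u'' v'' w''

variable {E : Type u} [NormedAddCommGroup E] [NormedSpace ℂ E]
  {H : Type v} [TopologicalSpace H] {I : ModelWithCorners ℂ E H}
  {M : Type w} [TopologicalSpace M] [ChartedSpace H M]
  {E' : Type u'} [NormedAddCommGroup E'] [NormedSpace ℂ E']
  {H' : Type v'} [TopologicalSpace H'] {I' : ModelWithCorners ℂ E' H'}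
  {M' : Type w'} [TopologicalSpace M'] [ChartedSpace H' M']
  {E'' : Type u''} [NormedAddCommGroup E''] [NormedSpace ℂ E'']
  {H'' : Type v''} [TopologicalSpace H''] {I'' : ModelWithCorners ℂ E'' H''}
  {M'' : Type w''} [TopologicalSpace M''] [ChartedSpace H'' M'']

theorem openPartialHomeomorph_mdifferentiable {φ : OpenPartialHomeomorph M M'}
    (h1 : ContMDiffOn I I' ω φ φ.source) (h2 : ContMDiffOn I' I ω φ.symm φ.target) :
    φ.MDifferentiable I I' :=
  ⟨h1.mdifferentiableOn (by simp), h2.mdifferentiableOn (by simp)⟩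

theorem GermIso.symm {A : TangentMul I M} {p : M} {A' : TangentMul I' M'} {p' : M'}
    (h : GermIso A p A' p') : GermIso A' p' A p := by
  obtain ⟨φ, hp, rfl, h1, h2, h3⟩ := h
  have hφ := openPartialHomeomorph_mdifferentiable h1 h2
  refine ⟨φ.symm, φ.map_source hp, φ.left_inv hp, h2, by simpa using h1, ?_⟩
  intro q hq
  have hs : φ.symm q ∈ φ.source := φ.map_target hq
  obtain ⟨hu, hm⟩ := h3 _ hs
  rw [φ.right_inv hq] at hu hm
  have hleft : ∀ u : TangentSpace I (φ.symm q),
      mfderiv I' I φ.symm q (mfderiv I I' φ (φ.symm q) u) = u := by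
    intro u
    have := hφ.symm_comp_deriv hs
    rw [φ.right_inv hq] at this
    exact congrArg (fun f => f u) this
  have hright : ∀ u : TangentSpace I' q,
      mfderiv I I' φ (φ.symm q) (mfderiv I' I φ.symm q u) = u :=
    fun u => congrArg (fun f => f u) (hφ.comp_symm_deriv hq)
  refine ⟨?_, fun u v => ?_⟩
  · exact (congrArg (mfderiv I' I φ.symm q) hu).symm.trans (hleft _)
  · have h := (hm (mfderiv I' I φ.symm q u) (mfderiv I' I φ.symm q v)).trans
      (congrArg₂ (fun a b => A'.mul q a b) (hright u) (hright v))
    exact (congrArg (mfderiv I' I φ.symm q) h).symm.trans (hleft _)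

theorem GermIso.trans {A : TangentMul I M} {p : M} {A' : TangentMul I' M'} {p' : M'}
    {A'' : TangentMul I'' M''} {p'' : M''} (h : GermIso A p A' p') (h' : GermIso A' p' A'' p'') :
    GermIso A p A'' p'' := by
  obtain ⟨φ, hp, rfl, h1, h2, h3⟩ := h
  obtain ⟨ψ, hp', rfl, h1', h2', h3'⟩ := h'
  have hφ := openPartialHomeomorph_mdifferentiable h1 h2
  have hψ := openPartialHomeomorph_mdifferentiable h1' h2'
  refine ⟨φ.trans ψ, ?_, rfl, ?_, ?_, ?_⟩
  · rw [φ.trans_source]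
    exact ⟨hp, hp'⟩
  · rw [φ.trans_source]
    exact h1'.comp (h1.mono inter_subset_left) fun q hq => hq.2
  · rw [φ.trans_target]
    exact h2.comp (h2'.mono inter_subset_left) fun q hq => hq.2
  · intro q hq
    rw [φ.trans_source] at hq
    obtain ⟨hu, hm⟩ := h3 q hq.1
    obtain ⟨hu', hm'⟩ := h3' _ hq.2
    have hc : mfderiv I I'' (φ.trans ψ) q
        = (mfderiv I' I'' ψ (φ q)).comp (mfderiv I I' φ q) :=
      mfderiv_comp q (hψ.mdifferentiableAt hq.2) (hφ.mdifferentiableAt hq.1)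
    rw [hc]
    refine ⟨?_, fun u v => ?_⟩
    · exact (congrArg _ hu).trans hu'
    · exact (congrArg _ (hm u v)).trans (hm' _ _)

theorem GermIso.exists_continuousLinearEquiv {A : TangentMul I M} {p : M} {A' : TangentMul I' M'}
    {p' : M'} (h : GermIso A p A' p') :
    ∃ L : TangentSpace I p →L[ℂ] TangentSpace I' p', Function.Bijective L ∧
      L (A.unit p) = A'.unit p' ∧ ∀ u v, L (A.mul p u v) = A'.mul p' (L u) (L v) := by
  obtain ⟨φ, hp, rfl, h1, h2, h3⟩ := h
  have hφ := openPartialHomeomorph_mdifferentiable h1 h2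
  exact ⟨mfderiv I I' φ p, (hφ.mfderiv hp).bijective, h3 p hp⟩

/-- Compatibility is needed only near `p`, since the source of the local inverse can be shrunk into
the set where it holds. All later coordinate changes of the plane pass through this criterion. -/
theorem germIso_of_analyticAt {A A' : TangentMul 𝓘(ℂ, ℂ × ℂ) (ℂ × ℂ)} {p : ℂ × ℂ}
    {Φ : ℂ × ℂ → ℂ × ℂ} (h : AnalyticAt ℂ Φ p) (hinj : ∀ v, fderiv ℂ Φ p v = 0 → v = 0)
    (hunit : ∀ᶠ t in 𝓝 p, fderiv ℂ Φ t (A.unit t) = A'.unit (Φ t))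
    (hmul : ∀ᶠ t in 𝓝 p, ∀ u v : ℂ × ℂ,
      fderiv ℂ Φ t (A.mul t u v) = A'.mul (Φ t) (fderiv ℂ Φ t u) (fderiv ℂ Φ t v)) :
    GermIso A p A' (Φ p) := by
  obtain ⟨Θ, hp, hΘ, hW, h1, h2⟩ := exists_openPartialHomeomorph h hinj (hunit.and hmul)
  refine ⟨Θ, hp, congrFun hΘ p, contMDiffOn_iff_contDiffOn.2 h1, contMDiffOn_iff_contDiffOn.2 h2,
    fun q hq => ?_⟩
  rw [mfderiv_eq_fderiv, hΘ]
  exact hW hq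

end GermIsomorphisms

/-! ### Characters and semisimplicity of the algebra with `∂₂ ∘ ∂₂ = b ∂₁`. -/

section PlanarAlgebra

open Set Filter

theorem planarBilin_apply (b : ℂ) (u v : ℂ × ℂ) :
    planarBilin b u v = (u.1 * v.1 + b * (u.2 * v.2), u.1 * v.2 + u.2 * v.1) := rfl

/-- The linear form with value `1` at `∂₁` and `s` at `∂₂`. -/
noncomputable def planarForm (s : ℂ) : ℂ × ℂ →ₗ[ℂ] ℂ :=
  LinearMap.fst ℂ ℂ ℂ + s • LinearMap.snd ℂ ℂ ℂ

theorem planarForm_apply (s : ℂ) (u : ℂ × ℂ) : planarForm s u = u.1 + s * u.2 := rfl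

theorem planarForm_injective : Function.Injective planarForm := by
  intro s s' h
  have := congrArg (fun f => f ((0, 1) : ℂ × ℂ)) h
  simpa [planarForm_apply] using this

/-- A unital character is determined by its value `s` at `∂₂`, and multiplicativity amounts to `s² =
b`. -/
theorem planarForm_eq_iff (b : ℂ) (χ : ℂ × ℂ →ₗ[ℂ] ℂ) :
    (χ (1, 0) = 1 ∧ ∀ u v, χ (planarBilin b u v) = χ u * χ v) ↔
      ∃ s, s ^ 2 = b ∧ planarForm s = χ := by
  constructor
  · rintro ⟨h1, h2⟩
    have h3 : χ (b, 0) = χ (0, 1) * χ (0, 1) := by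
      rw [← h2, planarBilin_apply]
      simp
    have h4 : ((b, 0) : ℂ × ℂ) = b • ((1, 0) : ℂ × ℂ) := by simp
    rw [h4, map_smul, h1, smul_eq_mul, mul_one] at h3
    refine ⟨χ (0, 1), ?_, ?_⟩
    · rw [h3, sq]
    · refine LinearMap.ext fun u => ?_
      have h5 : u = u.1 • ((1, 0) : ℂ × ℂ) + u.2 • ((0, 1) : ℂ × ℂ) := by
        ext <;> simp
      rw [planarForm_apply]
      conv_rhs => rw [h5, map_add, map_smul, map_smul, h1]
      simp [mul_comm]
  · rintro ⟨s, hs, rfl⟩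
    refine ⟨by simp [planarForm_apply], fun u v => ?_⟩
    rw [planarBilin_apply, planarForm_apply, planarForm_apply, planarForm_apply]
    linear_combination (-u.2 * v.2) * hs

theorem spectrumFibre_planarMul (β : ℂ × ℂ → ℂ) (t : ℂ × ℂ) :
    (planarMul β).spectrumFibre t = planarForm '' {s | s ^ 2 = β t} :=
  Set.ext fun χ => planarForm_eq_iff (β t) χ

theorem ncard_spectrumFibre_planarMul (β : ℂ × ℂ → ℂ) (t : ℂ × ℂ) :
    ((planarMul β).spectrumFibre t).ncard = {s : ℂ | s ^ 2 = β t}.ncard := by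
  rw [spectrumFibre_planarMul]
  exact ncard_image_of_injective _ planarForm_injective

theorem ncard_sq_eq_zero : {s : ℂ | s ^ 2 = 0}.ncard = 1 := by
  rw [ncard_eq_one]
  exact ⟨0, by ext s; simp⟩

theorem ncard_sq_eq {b : ℂ} (hb : b ≠ 0) : {s : ℂ | s ^ 2 = b}.ncard = 2 := by
  obtain ⟨r, rfl⟩ := IsAlgClosed.exists_pow_nat_eq b (n := 2) two_pos
  have hr : r ≠ -r := fun h => hb (by rw [self_eq_neg.1 h, zero_pow two_ne_zero])
  have : {s : ℂ | s ^ 2 = r ^ 2} = {r, -r} := by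
    ext s
    exact sq_eq_sq_iff_eq_or_eq_neg
  rw [this, ncard_pair hr]

theorem planarMul_caustic {β : ℂ × ℂ → ℂ} (hβ : Continuous β) (hd : Dense {t | β t ≠ 0}) :
    (planarMul β).caustic = {t | β t = 0} := by
  ext t
  constructor
  · rintro ⟨U, -, hU, h⟩
    obtain ⟨q, hq⟩ := hU.nonempty
    have := h q hq
    rw [ncard_spectrumFibre_planarMul, ncard_spectrumFibre_planarMul] at this
    by_contra hne
    rw [ncard_sq_eq hne] at this
    by_cases hq0 : β q = 0
    · rw [hq0, ncard_sq_eq_zero] at this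
      omega
    · rw [ncard_sq_eq hq0] at this
      omega
  · intro ht
    refine ⟨{t | β t ≠ 0}, isOpen_ne_fun hβ continuous_const, hd, fun q hq => ?_⟩
    rw [ncard_spectrumFibre_planarMul, ncard_spectrumFibre_planarMul, ncard_sq_eq hq,
      show β t = 0 from ht, ncard_sq_eq_zero]
    norm_num

theorem nilpotentPlane_caustic : nilpotentPlane.caustic = ∅ := by
  refine eq_empty_of_forall_notMem ?_
  rintro t ⟨U, -, hU, h⟩
  obtain ⟨q, hq⟩ := hU.nonempty
  have := h q hq
  rw [nilpotentPlane, ncard_spectrumFibre_planarMul, ncard_spectrumFibre_planarMul] at this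
  exact lt_irrefl _ this

theorem dense_snd_ne_zero : Dense {t : ℂ × ℂ | t.2 ≠ 0} :=
  (dense_compl_singleton (0 : ℂ)).preimage isOpenMap_snd

theorem I2_caustic {m : ℕ} (hm : 3 ≤ m) : (I2 m).caustic = {t : ℂ × ℂ | t.2 = 0} := by
  have h : ∀ t : ℂ × ℂ, t.2 ^ (m - 2) = 0 ↔ t.2 = 0 := fun t => by
    rw [pow_eq_zero_iff (by omega)]
  rw [I2, planarMul_caustic (by fun_prop)]
  · simp only [h]
  · simp only [ne_eq, h]
    exact dense_snd_ne_zero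

/-- The values of the generating function are `t₁ + (2/m) s t₂` with `s² = t₂^(m-2)`; they are two
distinct numbers exactly when `t₂ ≠ 0`. -/
theorem I2_bifurcationDiagram {m : ℕ} (hm : 3 ≤ m) :
    (I2 m).bifurcationDiagram (eulerI2 m) = {t : ℂ × ℂ | t.2 = 0} := by
  ext t
  have hm0 : (m : ℂ) ≠ 0 := by
    have : m ≠ 0 := by omega
    exact_mod_cast this
  have himg : (fun χ : TangentSpace 𝓘(ℂ, ℂ × ℂ) t →ₗ[ℂ] ℂ => χ (eulerI2 m t)) ''
      (I2 m).spectrumFibre t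
      = (fun s : ℂ => t.1 + s * (2 / (m : ℂ) * t.2)) '' {s : ℂ | s ^ 2 = t.2 ^ (m - 2)} := by
    rw [I2, spectrumFibre_planarMul]
    exact image_image (fun χ : ℂ × ℂ →ₗ[ℂ] ℂ => χ (t.1, 2 / (m : ℂ) * t.2)) planarForm _
  rw [TangentMul.bifurcationDiagram, mem_ofPred_eq, himg, mem_ofPred_eq, Module.finrank_prod,
    Module.finrank_self]
  by_cases ht : t.2 = 0
  · have h0 : (0 : ℂ) ^ (m - 2) = 0 := zero_pow (by omega)
    simp only [ht, h0, iff_true]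
    refine lt_of_le_of_lt (ncard_image_le ?_) ?_
    · exact finite_of_ncard_ne_zero (by rw [ncard_sq_eq_zero]; norm_num)
    · rw [ncard_sq_eq_zero]
      norm_num
  · rw [ncard_image_of_injective, ncard_sq_eq (pow_ne_zero _ ht)]
    · simp [ht]
    · intro s s' h
      have h2 : (2 / (m : ℂ) * t.2) ≠ 0 := mul_ne_zero (div_ne_zero two_ne_zero hm0) ht
      exact mul_right_cancel₀ h2 (add_left_cancel h)

/-- The expression `t₁² - (4/m²) t₂^m` is the product of `t₁ ± (2/m) s t₂` with `s² = t₂^(m-2)`. -/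
theorem I2_discriminant {m : ℕ} (hm : 2 ≤ m) :
    (I2 m).discriminant (eulerI2 m)
      = {t : ℂ × ℂ | t.1 ^ 2 - 4 / (m : ℂ) ^ 2 * t.2 ^ m = 0} := by
  ext t
  obtain ⟨k, rfl⟩ : ∃ k, m = k + 2 := ⟨m - 2, by omega⟩
  have hm0 : ((k + 2 : ℕ) : ℂ) ≠ 0 := by exact_mod_cast (by omega : k + 2 ≠ 0)
  have hiff : t ∈ (I2 (k + 2)).discriminant (eulerI2 (k + 2)) ↔
      ∃ s : ℂ, s ^ 2 = t.2 ^ k ∧ t.1 + s * (2 / ((k + 2 : ℕ) : ℂ) * t.2) = 0 := by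
    rw [TangentMul.discriminant, mem_ofPred_eq, I2, spectrumFibre_planarMul]
    exact exists_mem_image (f := planarForm) (p := fun χ => χ (t.1, 2 / ((k + 2 : ℕ) : ℂ) * t.2) =
        0)
  rw [hiff, mem_ofPred_eq]
  generalize ((k + 2 : ℕ) : ℂ) = c at hm0
  constructor
  · rintro ⟨s, hs, h⟩
    have h1 : t.1 = -(s * (2 / c * t.2)) := eq_neg_of_add_eq_zero_left h
    rw [h1]
    linear_combination (4 / c ^ 2 * t.2 ^ 2) * hs
  · intro h
    by_cases ht : t.2 = 0
    -- On `t₂ = 0` the equation reduces to `t₁ = 0`, and any root `s` serves.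
    · obtain ⟨s, hs⟩ := IsAlgClosed.exists_pow_nat_eq (t.2 ^ k) (n := 2) two_pos
      refine ⟨s, hs, ?_⟩
      rw [ht] at h ⊢
      have : t.1 ^ 2 = 0 := by simpa using h
      simpa using this
    · refine ⟨-(c * t.1 / (2 * t.2)), ?_, ?_⟩
      · field_simp
        field_simp at h
        linear_combination h
      · field_simp
        ring

/-- Semisimple algebras have no nonzero elements of square zero. -/
theorem TangentMul.IsSemisimpleAt.eq_zero_of_mul_self {E H M : Type*} [NormedAddCommGroup E]
    [NormedSpace ℂ E] [TopologicalSpace H] {I : ModelWithCorners ℂ E H} [TopologicalSpace M]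
    [ChartedSpace H M] {A : TangentMul I M} {p : M} (h : A.IsSemisimpleAt p)
    {u : TangentSpace I p} (hu : A.mul p u u = 0) : u = 0 := by
  obtain ⟨n, b, hb⟩ := h
  have h1 : A.mul p u u = ∑ i, (b.repr u i) ^ 2 • b i := by
    conv_lhs => rw [← b.sum_repr u]
    simp only [map_sum, LinearMap.sum_apply, map_smul, LinearMap.smul_apply, hb, smul_ite,
      smul_zero, sq]
    simp [smul_smul]
  rw [hu] at h1
  have h2 := Fintype.linearIndependent_iff.1 b.linearIndependent (fun i => (b.repr u i) ^ 2) h1.symm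
  refine b.ext_elem fun i => ?_
  simpa using h2 i

/-- The two characters, given by the roots `± r` of `b`, are coordinates identifying the algebra
with `ℂ²`; the idempotents form the dual basis. -/
theorem exists_basis_planarBilin {b : ℂ} (h0 : b ≠ 0) :
    ∃ (n : ℕ) (c : Module.Basis (Fin n) ℂ (ℂ × ℂ)),
      ∀ i j, planarBilin b (c i) (c j) = if i = j then c i else 0 := by
  obtain ⟨r, rfl⟩ := IsAlgClosed.exists_pow_nat_eq b (n := 2) two_pos
  have hr0 : r ≠ 0 := fun h => h0 (by rw [h, zero_pow two_ne_zero])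
  let e : (ℂ × ℂ) ≃ₗ[ℂ] (Fin 2 → ℂ) :=
    { toFun := fun u => ![u.1 + r * u.2, u.1 - r * u.2]
      map_add' := fun u v => by ext i; fin_cases i <;> simp <;> ring
      map_smul' := fun c u => by ext i; fin_cases i <;> simp <;> ring
      invFun := fun w => ((w 0 + w 1) / 2, (w 0 - w 1) / (2 * r))
      left_inv := fun u => by ext <;> simp <;> field_simp <;> ring
      right_inv := fun w => by ext i; fin_cases i <;> (simp; field_simp; ring) }
  refine ⟨2, Module.Basis.ofEquivFun e, fun i j => ?_⟩
  have hs : ∀ w : Fin 2 → ℂ, e.symm w = ((w 0 + w 1) / 2, (w 0 - w 1) / (2 * r)) := fun _ => rfl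
  rw [planarBilin_apply]
  fin_cases i <;> fin_cases j <;> simp [hs] <;> field_simp <;> norm_num

theorem planarMul_isSemisimpleAt_iff (β : ℂ × ℂ → ℂ) (t : ℂ × ℂ) :
    (planarMul β).IsSemisimpleAt t ↔ β t ≠ 0 := by
  refine ⟨fun h h0 => ?_, fun h0 => exists_basis_planarBilin h0⟩
  have h1 : planarBilin (β t) (0, 1) (0, 1) = 0 := by
    rw [planarBilin_apply, h0]
    simp
  have h2 : ((0, 1) : ℂ × ℂ) = 0 := h.eq_zero_of_mul_self h1
  simp at h2

theorem TangentMul.IsSemisimpleAt.map {E H M E' H' M' : Type*} [NormedAddCommGroup E]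
    [NormedSpace ℂ E] [TopologicalSpace H] {I : ModelWithCorners ℂ E H} [TopologicalSpace M]
    [ChartedSpace H M] [NormedAddCommGroup E']
    [NormedSpace ℂ E'] [TopologicalSpace H'] {I' : ModelWithCorners ℂ E' H'} [TopologicalSpace M']
    [ChartedSpace H' M'] {A : TangentMul I M} {p : M} {A' : TangentMul I' M'} {p' : M'}
    (L : TangentSpace I p ≃ₗ[ℂ] TangentSpace I' p')
    (hL : ∀ u v, L (A.mul p u v) = A'.mul p' (L u) (L v)) (h : A.IsSemisimpleAt p) :
    A'.IsSemisimpleAt p' := by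
  obtain ⟨n, b, hb⟩ := h
  refine ⟨n, b.map L, fun i j => ?_⟩
  rw [Module.Basis.map_apply, Module.Basis.map_apply, ← hL, hb]
  split_ifs <;> simp

theorem I2_isMassive (m : ℕ) : (I2 m).IsMassive := by
  refine dense_snd_ne_zero.mono fun t ht => ?_
  exact (planarMul_isSemisimpleAt_iff _ _).2 (pow_ne_zero _ ht)

theorem nilpotentPlane_not_isMassive : ¬ nilpotentPlane.IsMassive := by
  intro h
  obtain ⟨t, ht⟩ := h.nonempty
  exact (planarMul_isSemisimpleAt_iff _ _).1 ht rfl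

end PlanarAlgebra

/-! ### The Lie derivative of a planar multiplication. -/

section PlanarCalculus

open Set Filter

theorem holomorphicOn_plane_iff {X : ℂ × ℂ → ℂ × ℂ} {U : Set (ℂ × ℂ)} :
    HolomorphicOn (I := 𝓘(ℂ, ℂ × ℂ)) X U ↔ ContDiffOn ℂ ω X U :=
  contMDiffOn_vectorSpace_iff_contDiffOn

theorem mlieBracket_plane (X Y : ℂ × ℂ → ℂ × ℂ) (p : ℂ × ℂ) :
    VectorField.mlieBracket 𝓘(ℂ, ℂ × ℂ) X Y p = fderiv ℂ Y p (X p) - fderiv ℂ X p (Y p) := by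
  have h := congrFun (VectorField.mlieBracketWithin_eq_lieBracketWithin (𝕜 := ℂ) (V := X) (W := Y)
    (s := univ)) p
  rw [VectorField.lieBracketWithin_univ] at h
  exact h

theorem fderiv_planarBilin {β : ℂ × ℂ → ℂ} {Y Z : ℂ × ℂ → ℂ × ℂ} {p : ℂ × ℂ}
    (hβ : DifferentiableAt ℂ β p) (hY : DifferentiableAt ℂ Y p) (hZ : DifferentiableAt ℂ Z p)
    (v : ℂ × ℂ) :
    fderiv ℂ (fun t => planarBilin (β t) (Y t) (Z t)) p v =
      (fderiv ℂ β p v * ((Y p).2 * (Z p).2), 0) + planarBilin (β p) (fderiv ℂ Y p v) (Z p)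
        + planarBilin (β p) (Y p) (fderiv ℂ Z p v) := by
  have y1 : HasFDerivAt (fun t => (Y t).1) _ p := hY.hasFDerivAt.fst
  have y2 : HasFDerivAt (fun t => (Y t).2) _ p := hY.hasFDerivAt.snd
  have z1 : HasFDerivAt (fun t => (Z t).1) _ p := hZ.hasFDerivAt.fst
  have z2 : HasFDerivAt (fun t => (Z t).2) _ p := hZ.hasFDerivAt.snd
  have h := ((y1.fun_mul z1).fun_add (hβ.hasFDerivAt.fun_mul (y2.fun_mul z2))).prodMk
    ((y1.fun_mul z2).fun_add (y2.fun_mul z1))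
  have h' : (fun t => planarBilin (β t) (Y t) (Z t)) = fun t =>
    ((Y t).1 * (Z t).1 + β t * ((Y t).2 * (Z t).2), (Y t).1 * (Z t).2 + (Y t).2 * (Z t).1) := rfl
  rw [h', h.fderiv]
  ext
  · simp [planarBilin_apply]
    ring
  · simp [planarBilin_apply]
    ring

/-- The Lie derivative along `X` of the multiplication with `∂₂ ∘ ∂₂ = β ∂₁`, as a tensor. -/
noncomputable def lieTensor (β : ℂ × ℂ → ℂ) (X : ℂ × ℂ → ℂ × ℂ) (p u v : ℂ × ℂ) : ℂ × ℂ :=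
  (fderiv ℂ β p (X p) * (u.2 * v.2), 0) - fderiv ℂ X p (planarBilin (β p) u v)
    + planarBilin (β p) (fderiv ℂ X p u) v + planarBilin (β p) u (fderiv ℂ X p v)

/-- By the Leibniz rule the derivatives of `Y` and `Z` cancel. The remaining questions concern
vectors at one point and the first derivatives of `X`. -/
theorem lieMul_planarMul {β : ℂ × ℂ → ℂ} (X : ℂ × ℂ → ℂ × ℂ) {Y Z : ℂ × ℂ → ℂ × ℂ} {p : ℂ × ℂ}
    (hβ : DifferentiableAt ℂ β p) (hY : DifferentiableAt ℂ Y p) (hZ : DifferentiableAt ℂ Z p) :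
    (planarMul β).lieMul X Y Z p = lieTensor β X p (Y p) (Z p) := by
  have h : fderiv ℂ (fun t => planarBilin (β t) (Y t) (Z t)) p (X p)
      - fderiv ℂ X p (planarBilin (β p) (Y p) (Z p))
      - planarBilin (β p) (fderiv ℂ Y p (X p) - fderiv ℂ X p (Y p)) (Z p)
      - planarBilin (β p) (Y p) (fderiv ℂ Z p (X p) - fderiv ℂ X p (Z p))
      = lieTensor β X p (Y p) (Z p) := by
    rw [fderiv_planarBilin hβ hY hZ, lieTensor]
    simp only [map_sub, LinearMap.sub_apply]
    abel
  rw [← h, ← mlieBracket_plane, ← mlieBracket_plane, ← mlieBracket_plane]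
  rfl

theorem fderiv_apply_eq (X : ℂ × ℂ → ℂ × ℂ) (p v : ℂ × ℂ) :
    fderiv ℂ X p v = v.1 • fderiv ℂ X p (1, 0) + v.2 • fderiv ℂ X p (0, 1) := by
  have h5 : v = v.1 • ((1, 0) : ℂ × ℂ) + v.2 • ((0, 1) : ℂ × ℂ) := by
    ext <;> simp
  conv_lhs => rw [h5, map_add, map_smul, map_smul]

theorem fderiv_comp_snd {g : ℂ → ℂ} {p : ℂ × ℂ} (hg : DifferentiableAt ℂ g p.2) (v : ℂ × ℂ) :
    fderiv ℂ (fun t : ℂ × ℂ => g t.2) p v = v.2 * deriv g p.2 := by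
  have h : HasFDerivAt (fun t : ℂ × ℂ => g t.2) _ p :=
    hg.hasDerivAt.hasFDerivAt.comp p hasFDerivAt_snd
  rw [h.fderiv]
  simp

theorem planarBilin_comm (b : ℂ) (u v : ℂ × ℂ) : planarBilin b u v = planarBilin b v u := by
  simp only [planarBilin_apply]
  ext <;> dsimp only <;> ring

theorem planarBilin_assoc (b : ℂ) (u v w : ℂ × ℂ) :
    planarBilin b (planarBilin b u v) w = planarBilin b u (planarBilin b v w) := by
  simp only [planarBilin_apply]
  ext <;> dsimp only <;> ring

theorem planarBilin_one (b : ℂ) (u : ℂ × ℂ) : planarBilin b (1, 0) u = u := by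
  simp [planarBilin_apply]

/-- Once the first derivatives at `p` are named, this is a polynomial identity. It depends on `g`
being a function of `t₂` only: taking `X = Y = e` forces `Lie_e(∘) = 0`. -/
theorem lieTensor_planarBilin {g : ℂ → ℂ} {X Y : ℂ × ℂ → ℂ × ℂ} {p : ℂ × ℂ}
    (hg : DifferentiableAt ℂ g p.2) (hX : DifferentiableAt ℂ X p) (hY : DifferentiableAt ℂ Y p)
    (z w : ℂ × ℂ) :
    lieTensor (fun t => g t.2) (fun t => planarBilin (g t.2) (X t) (Y t)) p z w =
      planarBilin (g p.2) (X p) (lieTensor (fun t => g t.2) Y p z w)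
        + planarBilin (g p.2) (Y p) (lieTensor (fun t => g t.2) X p z w) := by
  have hβ : DifferentiableAt ℂ (fun t : ℂ × ℂ => g t.2) p :=
    DifferentiableAt.comp (g := g) p hg differentiableAt_snd
  simp only [lieTensor, fderiv_planarBilin hβ hX hY]
  simp only [fderiv_comp_snd hg, fderiv_apply_eq X p z, fderiv_apply_eq X p w,
    fderiv_apply_eq Y p z, fderiv_apply_eq Y p w,
    fderiv_apply_eq X p (planarBilin _ _ _), fderiv_apply_eq Y p (planarBilin _ _ _)]
  generalize fderiv ℂ X p (1, 0) = X₁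
  generalize fderiv ℂ X p (0, 1) = X₂
  generalize fderiv ℂ Y p (1, 0) = Y₁
  generalize fderiv ℂ Y p (0, 1) = Y₂
  simp only [planarBilin_apply]
  ext
  · simp
    ring
  · simp
    ring

theorem isFManifold_planarMul {g : ℂ → ℂ} (hg : ContDiff ℂ ω g) :
    (planarMul fun t => g t.2).IsFManifold where
  connected := inferInstance
  dim_pos := by simp
  mul_comm p u v := planarBilin_comm _ u v
  mul_assoc p u v w := planarBilin_assoc _ u v w
  unit_mul p u := planarBilin_one _ u
  holomorphic_unit := holomorphicOn_plane_iff.2 contDiffOn_const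
  holomorphic_mul U hU X Y hX hY := by
    have hX' := holomorphicOn_plane_iff.1 hX
    have hY' := holomorphicOn_plane_iff.1 hY
    refine holomorphicOn_plane_iff.2 ?_
    have hβ : ContDiffOn ℂ ω (fun t : ℂ × ℂ => g t.2) U := (hg.comp contDiff_snd).contDiffOn
    exact ((hX'.fst.mul hY'.fst).add (hβ.mul (hX'.snd.mul hY'.snd))).prodMk
      ((hX'.fst.mul hY'.snd).add (hX'.snd.mul hY'.fst))
  lie_mul U hU X Y Z W hX hY hZ hW p hp := by
    have hd : ∀ {X : ℂ × ℂ → ℂ × ℂ}, HolomorphicOn (I := 𝓘(ℂ, ℂ × ℂ)) X U →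
        DifferentiableAt ℂ X p := fun h =>
      ((holomorphicOn_plane_iff.1 h).differentiableOn (by simp)).differentiableAt
        (hU.mem_nhds hp)
    have hgd : DifferentiableAt ℂ g p.2 := (hg.differentiable (by simp)) _
    have hβ : DifferentiableAt ℂ (fun t : ℂ × ℂ => g t.2) p :=
      DifferentiableAt.comp (g := g) p hgd differentiableAt_snd
    have hL : ∀ X : ℂ × ℂ → ℂ × ℂ, (planarMul fun t => g t.2).lieMul X Z W p = _ :=
      fun X => lieMul_planarMul X hβ (hd hZ) (hd hW)
    exact (hL _).trans ((lieTensor_planarBilin hgd (hd hX) (hd hY) _ _).trans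
      (congrArg₂ (fun a b => planarBilin (g p.2) (X p) a + planarBilin (g p.2) (Y p) b)
        (hL Y).symm (hL X).symm))

/-- The equations come from the pairs `(∂₁, ∂₁)` and `(∂₂, ∂₂)`; the mixed pair adds nothing. -/
theorem lieTensor_eq_smul_iff {g : ℂ → ℂ} {X : ℂ × ℂ → ℂ × ℂ} {p : ℂ × ℂ}
    (hg : DifferentiableAt ℂ g p.2) (d : ℂ) :
    (∀ u v, lieTensor (fun t => g t.2) X p u v = d • planarBilin (g p.2) u v) ↔
      fderiv ℂ X p (1, 0) = (d, 0) ∧ (fderiv ℂ X p (0, 1)).1 = 0 ∧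
        (X p).2 * deriv g p.2 + 2 * (g p.2 * (fderiv ℂ X p (0, 1)).2) = 2 * d * g p.2 := by
  simp only [lieTensor, fderiv_comp_snd hg]
  constructor
  · intro h
    have h1 := h (1, 0) (1, 0)
    have h2 := h (0, 1) (0, 1)
    simp only [planarBilin_one, fderiv_apply_eq X p (planarBilin _ _ _)] at h1 h2
    rw [planarBilin_comm, planarBilin_one] at h1
    have h3 : fderiv ℂ X p (1, 0) = (d, 0) := by
      simpa [Prod.mk_zero_zero] using h1
    refine ⟨h3, ?_, ?_⟩
    · have := congrArg Prod.snd h2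
      simp [planarBilin_apply, h3] at this
      exact this
    · have := congrArg Prod.fst h2
      simp [planarBilin_apply, h3] at this
      linear_combination this
  · rintro ⟨h1, h2, h3⟩ u v
    rw [fderiv_apply_eq X p u, fderiv_apply_eq X p v, fderiv_apply_eq X p (planarBilin _ _ _), h1]
    simp only [planarBilin_apply]
    ext
    · simp [h2]
      linear_combination (u.2 * v.2) * h3
    · simp [h2]
      ring

/-- The equations for Euler fields of the multiplication `∂₂ ∘ ∂₂ = g(t₂) ∂₁`. -/
theorem isEulerFieldOn_planarMul_iff {g : ℂ → ℂ} (hg : Differentiable ℂ g) {U : Set (ℂ × ℂ)}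
    {d : ℂ} {X : ℂ × ℂ → ℂ × ℂ} :
    (planarMul fun t => g t.2).IsEulerFieldOn U d X ↔ IsOpen U ∧ ContDiffOn ℂ ω X U ∧
      ∀ p ∈ U, fderiv ℂ X p (1, 0) = (d, 0) ∧ (fderiv ℂ X p (0, 1)).1 = 0 ∧
        (X p).2 * deriv g p.2 + 2 * (g p.2 * (fderiv ℂ X p (0, 1)).2) = 2 * d * g p.2 := by
  have hβ : ∀ p, DifferentiableAt ℂ (fun t : ℂ × ℂ => g t.2) p := fun p =>
    DifferentiableAt.comp (g := g) p (hg _) differentiableAt_snd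
  refine and_congr_right fun hU => and_congr holomorphicOn_plane_iff ?_
  constructor
  · intro h p hp
    refine (lieTensor_eq_smul_iff (hg p.2) d).1 fun u v => ?_
    have h1 := h U subset_rfl hU (fun _ => u) (fun _ => v)
      (holomorphicOn_plane_iff.2 contDiffOn_const) (holomorphicOn_plane_iff.2 contDiffOn_const) p hp
    exact (lieMul_planarMul X (hβ p) (differentiableAt_const _)
        (differentiableAt_const _)).symm.trans
      h1
  · intro h V hV hVo Y Z hY hZ p hp
    have hd : ∀ {X : ℂ × ℂ → ℂ × ℂ}, HolomorphicOn (I := 𝓘(ℂ, ℂ × ℂ)) X V →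
        DifferentiableAt ℂ X p := fun h =>
      ((holomorphicOn_plane_iff.1 h).differentiableOn (by simp)).differentiableAt
        (hVo.mem_nhds hp)
    exact (lieMul_planarMul X (hβ p) (hd hY) (hd hZ)).trans
      ((lieTensor_eq_smul_iff (hg p.2) d).2 (h p (hV hp)) _ _)

end PlanarCalculus

/-! ### Euler fields of the models. -/

section EulerFields

open Set Filter Metric

theorem I2_isFManifold (m : ℕ) : (I2 m).IsFManifold :=
  isFManifold_planarMul (g := fun s => s ^ (m - 2)) (by fun_prop)

theorem nilpotentPlane_isFManifold : nilpotentPlane.IsFManifold :=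
  isFManifold_planarMul (g := fun _ => 0) contDiff_const

theorem I2_isEulerFieldOn_iff {m : ℕ} {U : Set (ℂ × ℂ)} {d : ℂ} {X : ℂ × ℂ → ℂ × ℂ} :
    (I2 m).IsEulerFieldOn U d X ↔ IsOpen U ∧ ContDiffOn ℂ ω X U ∧
      ∀ p ∈ U, fderiv ℂ X p (1, 0) = (d, 0) ∧ (fderiv ℂ X p (0, 1)).1 = 0 ∧
        (X p).2 * (((m - 2 : ℕ) : ℂ) * p.2 ^ (m - 2 - 1))
          + 2 * (p.2 ^ (m - 2) * (fderiv ℂ X p (0, 1)).2) = 2 * d * p.2 ^ (m - 2) := by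
  have h := isEulerFieldOn_planarMul_iff (g := fun s => s ^ (m - 2)) (by fun_prop) (U := U) (d := d)
    (X := X)
  simp only [deriv_pow_field] at h
  exact h

theorem nilpotentPlane_isEulerFieldOn_iff {U : Set (ℂ × ℂ)} {d : ℂ} {X : ℂ × ℂ → ℂ × ℂ} :
    nilpotentPlane.IsEulerFieldOn U d X ↔ IsOpen U ∧ ContDiffOn ℂ ω X U ∧
      ∀ p ∈ U, fderiv ℂ X p (1, 0) = (d, 0) ∧ (fderiv ℂ X p (0, 1)).1 = 0 := by
  have h := isEulerFieldOn_planarMul_iff (g := fun _ => 0) (by fun_prop) (U := U) (d := d)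
    (X := X)
  simp only [deriv_const, mul_zero, zero_mul, add_zero, and_true] at h
  exact h

/-- At `k = 0` the truncated exponent is harmless because the coefficient vanishes; this is the case
`m = 2` of the Euler equation. -/
theorem mul_natCast_mul_pow (z : ℂ) (k : ℕ) : z * ((k : ℂ) * z ^ (k - 1)) = k * z ^ k := by
  cases k with
  | zero => simp
  | succ k =>
    rw [Nat.add_sub_cancel]
    ring

theorem fderiv_affine (a b c d : ℂ) (p v : ℂ × ℂ) :
    fderiv ℂ (fun t : ℂ × ℂ => (a * t.1 + c, b * t.2 + d)) p v = (a * v.1, b * v.2) := by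
  have h : HasFDerivAt (fun t : ℂ × ℂ => (a * t.1 + c, b * t.2 + d)) _ p :=
    (((hasFDerivAt_fst (𝕜 := ℂ) (E := ℂ) (F := ℂ) (p := p)).const_mul a).add_const c).prodMk
      (((hasFDerivAt_snd (𝕜 := ℂ) (E := ℂ) (F := ℂ) (p := p)).const_mul b).add_const d)
  rw [h.fderiv]
  rfl

theorem I2_isEulerFieldOn_affine {m : ℕ} (hm : 2 ≤ m) {U : Set (ℂ × ℂ)} (hU : IsOpen U) (d c : ℂ)
    {X : ℂ × ℂ → ℂ × ℂ} (hX : EqOn X (fun t => (d * t.1 + c, d * (2 / (m : ℂ)) * t.2 + 0)) U) :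
    (I2 m).IsEulerFieldOn U d X := by
  have hm0 : (m : ℂ) ≠ 0 := by exact_mod_cast (by omega : m ≠ 0)
  refine I2_isEulerFieldOn_iff.2 ⟨hU, ContDiffOn.congr (by fun_prop) hX, fun p hp => ?_⟩
  have h := (hX.eventuallyEq_of_mem (hU.mem_nhds hp)).fderiv_eq (𝕜 := ℂ)
  simp only [h, fderiv_affine, hX hp]
  refine ⟨by simp, by simp, ?_⟩
  have hk := mul_natCast_mul_pow p.2 (m - 2)
  have hcast : ((m - 2 : ℕ) : ℂ) = m - 2 := by push_cast [Nat.cast_sub hm]; rfl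
  rw [hcast] at hk ⊢
  have : d * (2 / (m : ℂ)) * p.2 * (((m : ℂ) - 2) * p.2 ^ (m - 2 - 1))
      = d * (2 / (m : ℂ)) * (((m : ℂ) - 2) * p.2 ^ (m - 2)) := by rw [← hk]; ring
  rw [add_zero, this]
  field_simp
  ring

theorem I2_isEulerField {m : ℕ} (hm : 2 ≤ m) : (I2 m).IsEulerField 1 (eulerI2 m) :=
  I2_isEulerFieldOn_affine hm isOpen_univ 1 0 fun t _ =>
    Prod.ext (by simp [eulerI2]) (by simp [eulerI2])

theorem nilpotentPlane_isEulerField :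
    nilpotentPlane.IsEulerField 1 (fun t : ℂ × ℂ => ((t.1, 0) : ℂ × ℂ)) := by
  refine nilpotentPlane_isEulerFieldOn_iff.2 ⟨isOpen_univ, by fun_prop, fun p _ => ?_⟩
  have h : (fun t : ℂ × ℂ => ((t.1, 0) : ℂ × ℂ)) = fun t => (1 * t.1 + 0, 0 * t.2 + 0) := by
    ext t <;> simp
  rw [h, fderiv_affine, fderiv_affine]
  simp

theorem eqOn_ball_of_fderiv_eq_zero {f : ℂ × ℂ → ℂ} {r : ℝ} (hf : DifferentiableOn ℂ f (ball 0 r))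
    (h1 : ∀ p ∈ ball (0 : ℂ × ℂ) r, fderiv ℂ f p (1, 0) = 0)
    (h2 : ∀ p ∈ ball (0 : ℂ × ℂ) r, fderiv ℂ f p (0, 1) = 0) {p : ℂ × ℂ} (hp : p ∈ ball 0 r) :
    f p = f 0 := by
  have hr : 0 < r := pos_of_mem_ball hp
  refine isOpen_ball.is_const_of_fderiv_eq_zero (convex_ball _ _).isPreconnected hf ?_ hp
    (mem_ball_self hr)
  intro q hq
  ext
  · exact h1 q hq
  · exact h2 q hq

/-- A function on a ball of the plane whose derivative along `∂₁` vanishes depends on the second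
coordinate only. -/
theorem eq_of_fderiv_fst_eq_zero {F : Type*} [NormedAddCommGroup F] [NormedSpace ℂ F]
    {f : ℂ × ℂ → F} {r : ℝ} (hf : DifferentiableOn ℂ f (ball 0 r))
    (h1 : ∀ p ∈ ball (0 : ℂ × ℂ) r, fderiv ℂ f p (1, 0) = 0) {p : ℂ × ℂ} (hp : p ∈ ball 0 r) :
    f p = f (0, p.2) := by
  have hr : 0 < r := pos_of_mem_ball hp
  rw [← Prod.mk_zero_zero, ← ball_prod_same] at hp hf h1
  have hd : ∀ s ∈ ball (0 : ℂ) r, HasDerivAt (fun s => f (s, p.2)) 0 s := by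
    intro s hs
    have hmem : (s, p.2) ∈ ball (0 : ℂ) r ×ˢ ball (0 : ℂ) r := ⟨hs, hp.2⟩
    have h2 := (hf.differentiableAt ((isOpen_ball.prod isOpen_ball).mem_nhds hmem)).hasFDerivAt
    have h3 : HasDerivAt (fun s : ℂ => (s, p.2)) ((1, 0) : ℂ × ℂ) s :=
      (hasDerivAt_id s).prodMk (hasDerivAt_const s p.2)
    have h4 := h2.comp_hasDerivAt s h3
    rwa [h1 _ hmem] at h4
  exact isOpen_ball.is_const_of_deriv_eq_zero (convex_ball _ _).isPreconnected
    (fun s hs => (hd s hs).differentiableAt.differentiableWithinAt) (fun s hs => (hd s hs).deriv)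
    hp.1 (mem_ball_self hr)

/-- The first component of `X` minus `d t₁` has zero derivative, hence is constant. For `h = X₂ -
(2d/m) t₂` the last Euler equation says that `h² t₂^(m-2)` has zero derivative. This function
vanishes at the origin since `m ≥ 3`, so `h = 0`. -/
theorem I2_isEulerGermAt_iff {m : ℕ} (hm : 3 ≤ m) (d : ℂ)
    (X : ∀ t : ℂ × ℂ, TangentSpace 𝓘(ℂ, ℂ × ℂ) t) :
    (I2 m).IsEulerGermAt (0 : ℂ × ℂ) d X ↔
      ∃ c : ℂ, ∀ᶠ t in 𝓝 (0 : ℂ × ℂ), X t = d • eulerI2 m t + c • (I2 m).unit t := by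
  have hm0 : (m : ℂ) ≠ 0 := by exact_mod_cast (by omega : m ≠ 0)
  have hform : ∀ (c : ℂ) (t : ℂ × ℂ), d • ((t.1, 2 / (m : ℂ) * t.2) : ℂ × ℂ) + c • ((1, 0) : ℂ × ℂ)
      = (d * t.1 + c, d * (2 / (m : ℂ)) * t.2 + 0) := by
    intro c t
    ext <;> simp
    ring
  change (ℂ × ℂ → ℂ × ℂ) at X
  constructor
  · rintro ⟨U, h0, hU⟩
    obtain ⟨hUo, hX, hE⟩ := I2_isEulerFieldOn_iff.1 hU
    obtain ⟨r, hr, hrU⟩ := Metric.isOpen_iff.1 hUo 0 h0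
    have hXd : ∀ p ∈ ball (0 : ℂ × ℂ) r, DifferentiableAt ℂ X p := fun p hp =>
      (hX.differentiableOn (by simp)).differentiableAt (hUo.mem_nhds (hrU hp))
    have hd1 : ∀ p ∈ ball (0 : ℂ × ℂ) r, HasFDerivAt (fun t : ℂ × ℂ => (X t).1 - d * t.1)
        ((ContinuousLinearMap.fst ℂ ℂ ℂ).comp (fderiv ℂ X p)
          - d • ContinuousLinearMap.fst ℂ ℂ ℂ) p := fun p hp =>
      (hXd p hp).hasFDerivAt.fst.fun_sub
        ((hasFDerivAt_fst (𝕜 := ℂ) (E := ℂ) (F := ℂ) (p := p)).const_mul d)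
    have hd2 : ∀ p ∈ ball (0 : ℂ × ℂ) r, HasFDerivAt
        (fun t : ℂ × ℂ => (X t).2 - d * (2 / (m : ℂ)) * t.2)
        ((ContinuousLinearMap.snd ℂ ℂ ℂ).comp (fderiv ℂ X p)
          - (d * (2 / (m : ℂ))) • ContinuousLinearMap.snd ℂ ℂ ℂ) p := fun p hp =>
      (hXd p hp).hasFDerivAt.snd.fun_sub
        ((hasFDerivAt_snd (𝕜 := ℂ) (E := ℂ) (F := ℂ) (p := p)).const_mul _)
    -- Here `m - 2 = k + 1` is visibly positive, so the conserved quantity `h² t₂^(k+1)` is zero at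
    -- the origin.
    obtain ⟨k, rfl⟩ : ∃ k, m = k + 1 + 2 := ⟨m - 3, by omega⟩
    have hd3 : ∀ p ∈ ball (0 : ℂ × ℂ) r, HasFDerivAt
        (fun t : ℂ × ℂ => ((X t).2 - d * (2 / ((k + 1 + 2 : ℕ) : ℂ)) * t.2) ^ 2 * t.2 ^ (k + 1))
        _ p := fun p hp =>
      ((hd2 p hp).pow 2).fun_mul ((hasFDerivAt_snd (𝕜 := ℂ) (E := ℂ) (F := ℂ) (p := p)).pow (k + 1))
    have h1 : ∀ p ∈ ball (0 : ℂ × ℂ) r, (X p).1 - d * p.1 = (X 0).1 := by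
      intro p hp
      refine (eqOn_ball_of_fderiv_eq_zero (f := fun t => (X t).1 - d * t.1) (r := r)
        (fun q hq => (hd1 q hq).differentiableAt.differentiableWithinAt) ?_ ?_ hp).trans (by simp)
      · intro q hq
        rw [(hd1 q hq).fderiv]
        simp [(hE q (hrU hq)).1]
      · intro q hq
        rw [(hd1 q hq).fderiv]
        simp [(hE q (hrU hq)).2.1]
    have h3 : ∀ p ∈ ball (0 : ℂ × ℂ) r,
        ((X p).2 - d * (2 / ((k + 1 + 2 : ℕ) : ℂ)) * p.2) ^ 2 * p.2 ^ (k + 1) = 0 := by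
      intro p hp
      refine (eqOn_ball_of_fderiv_eq_zero
        (fun q hq => (hd3 q hq).differentiableAt.differentiableWithinAt) ?_ ?_ hp).trans (by simp)
      · intro q hq
        rw [(hd3 q hq).fderiv]
        simp [(hE q (hrU hq)).1]
      · intro q hq
        rw [(hd3 q hq).fderiv]
        have h4 := (hE q (hrU hq)).2.2
        have he : d * (2 / ((k + 1 + 2 : ℕ) : ℂ)) * (k + 3) = 2 * d := by
          push_cast at hm0 ⊢
          field_simp
          ring
        generalize d * (2 / ((k + 1 + 2 : ℕ) : ℂ)) = e at he
        simp at h4 ⊢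
        linear_combination ((X q).2 - e * q.2) * h4 - ((X q).2 - e * q.2) * q.2 ^ (k + 1) * he
    have h4 : ∀ p ∈ ball (0 : ℂ × ℂ) r, p.2 ≠ 0 →
        (X p).2 = d * (2 / ((k + 1 + 2 : ℕ) : ℂ)) * p.2 := by
      intro p hp hp2
      have := (mul_eq_zero.1 (h3 p hp)).resolve_right (pow_ne_zero _ hp2)
      exact sub_eq_zero.1 (pow_eq_zero_iff two_ne_zero |>.1 this)
    have h5 : ∀ p ∈ ball (0 : ℂ × ℂ) r, (X p).2 = d * (2 / ((k + 1 + 2 : ℕ) : ℂ)) * p.2 := by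
      intro p hp
      -- Division by `t₂^(k+1)` is impossible on `t₂ = 0`; there the formula follows by continuity
      -- from the dense complement.
      have hcl : p ∈ closure ({t : ℂ × ℂ | t.2 ≠ 0} ∩ ball 0 r) := by
        rw [inter_comm]
        exact isOpen_ball.inter_closure ⟨hp, dense_snd_ne_zero p⟩
      have := mem_closure_iff_nhdsWithin_neBot.1 hcl
      refine tendsto_nhds_unique_of_eventuallyEq (l := 𝓝[{t : ℂ × ℂ | t.2 ≠ 0} ∩ ball 0 r] p)
        (f := fun t => (X t).2) (g := fun t => d * (2 / ((k + 1 + 2 : ℕ) : ℂ)) * t.2) ?_ ?_ ?_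
      · exact ((hXd p hp).continuousAt.snd).continuousWithinAt
      · exact Continuous.continuousWithinAt (by fun_prop)
      · filter_upwards [self_mem_nhdsWithin] with t ht using h4 t ht.2 ht.1
    refine ⟨(X 0).1, ?_⟩
    filter_upwards [ball_mem_nhds (0 : ℂ × ℂ) hr] with p hp
    refine Eq.trans ?_ (hform (X 0).1 p).symm
    refine Prod.ext ?_ ?_
    · change (X p).1 = d * p.1 + (X 0).1
      rw [← h1 p hp]
      ring
    · change (X p).2 = _ * p.2 + 0
      rw [h5 p hp, add_zero]
  · rintro ⟨c, h⟩
    obtain ⟨r, hr, hball⟩ := Metric.eventually_nhds_iff_ball.1 h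
    refine ⟨ball 0 r, mem_ball_self hr, I2_isEulerFieldOn_affine (by omega) isOpen_ball d c ?_⟩
    exact fun t ht => (hball t ht).trans (hform c t)

theorem nilpotentPlane_isEulerGermAt_iff (X : ∀ t : ℂ × ℂ, TangentSpace 𝓘(ℂ, ℂ × ℂ) t) :
    nilpotentPlane.IsEulerGermAt (0 : ℂ × ℂ) 0 X ↔
      ∃ (ε₁ : ℂ) (ε₂ : ℂ → ℂ), AnalyticAt ℂ ε₂ 0 ∧
        ∀ᶠ t in 𝓝 (0 : ℂ × ℂ), X t = ((ε₁, ε₂ t.2) : ℂ × ℂ) := by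
  change (ℂ × ℂ → ℂ × ℂ) at X
  constructor
  · rintro ⟨U, h0, hU⟩
    obtain ⟨hUo, hX, hE⟩ := nilpotentPlane_isEulerFieldOn_iff.1 hU
    obtain ⟨r, hr, hrU⟩ := Metric.isOpen_iff.1 hUo 0 h0
    have hXd : ∀ p ∈ ball (0 : ℂ × ℂ) r, DifferentiableAt ℂ X p := fun p hp =>
      (hX.differentiableOn (by simp)).differentiableAt (hUo.mem_nhds (hrU hp))
    have hXa : AnalyticAt ℂ X 0 := (hX.contDiffAt (hUo.mem_nhds h0)).analyticAt
    refine ⟨(X 0).1, fun s => (X (0, s)).2, ?_, ?_⟩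
    · exact analyticAt_snd.comp (AnalyticAt.comp (g := X) hXa
        (analyticAt_const.prod analyticAt_id))
    · filter_upwards [ball_mem_nhds (0 : ℂ × ℂ) hr] with p hp
      refine Prod.ext ?_ ?_
      · refine eqOn_ball_of_fderiv_eq_zero (f := fun t => (X t).1)
          (fun q hq => (hXd q hq).fst.differentiableWithinAt) ?_ ?_ hp
        · intro q hq
          rw [(hXd q hq).hasFDerivAt.fst.fderiv]
          exact congrArg Prod.fst (hE q (hrU hq)).1
        · intro q hq
          rw [(hXd q hq).hasFDerivAt.fst.fderiv]
          exact (hE q (hrU hq)).2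
      · change (X p).2 = (X (0, p.2)).2
        exact congrArg Prod.snd (eq_of_fderiv_fst_eq_zero
          (fun q hq => (hXd q hq).differentiableWithinAt) (fun q hq => (hE q (hrU hq)).1) hp)
  · rintro ⟨ε₁, ε₂, hε, h⟩
    have h2 : ∀ᶠ t : ℂ × ℂ in 𝓝 0, AnalyticAt ℂ ε₂ t.2 :=
      continuous_snd.continuousAt.eventually hε.eventually_analyticAt
    obtain ⟨r, hr, hball⟩ := Metric.eventually_nhds_iff_ball.1 (h.and h2)
    have hXe : EqOn X (fun t => (ε₁, ε₂ t.2)) (ball 0 r) := fun t ht => (hball t ht).1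
    refine ⟨ball 0 r, mem_ball_self hr, nilpotentPlane_isEulerFieldOn_iff.2
      ⟨isOpen_ball, ContDiffOn.congr (fun t ht => ?_) hXe, fun p hp => ?_⟩⟩
    · exact (contDiffAt_const.prodMk
        ((hball t ht).2.contDiffAt.comp t contDiffAt_snd)).contDiffWithinAt
    · have hd := (hball p hp).2.differentiableAt
      have h5 : HasFDerivAt (fun t : ℂ × ℂ => (ε₁, ε₂ t.2)) _ p :=
        (hasFDerivAt_const ε₁ p).prodMk (hd.hasFDerivAt.comp p hasFDerivAt_snd)
      rw [(hXe.eventuallyEq_of_mem (isOpen_ball.mem_nhds hp)).fderiv_eq, h5.fderiv]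
      simp

end EulerFields

/-! ### The germ `I₂(2)` is `A₁²`. -/

section Models

open Filter

/-- For `m = 2` the product is constant, and its two characters `u₁ ± u₂` are linear coordinates
that split it. -/
theorem I2_two_germIso_A1Sq : GermIso (I2 2) (0 : ℂ × ℂ) A1Sq (0 : ℂ × ℂ) := by
  let L : ℂ × ℂ →L[ℂ] ℂ × ℂ :=
    (ContinuousLinearMap.fst ℂ ℂ ℂ + ContinuousLinearMap.snd ℂ ℂ ℂ).prod
      (ContinuousLinearMap.fst ℂ ℂ ℂ - ContinuousLinearMap.snd ℂ ℂ ℂ)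
  have hL : ∀ v, L v = (v.1 + v.2, v.1 - v.2) := fun _ => rfl
  have h := germIso_of_analyticAt (A := I2 2) (A' := A1Sq) (p := 0) (Φ := L) (L.analyticAt 0)
    (by
      intro v hv
      rw [L.fderiv, hL, Prod.mk_eq_zero] at hv
      have h1 : v.1 = 0 := by linear_combination (hv.1 + hv.2) / 2
      have h2 : v.2 = 0 := by linear_combination (hv.1 - hv.2) / 2
      exact Prod.ext h1 h2)
    (Eventually.of_forall fun t => by
      rw [L.fderiv]
      exact (hL (1, 0)).trans (by simp; rfl))
    (Eventually.of_forall fun t u v => by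
      rw [L.fderiv]
      refine (hL (planarBilin (t.2 ^ (2 - 2)) u v)).trans ?_
      refine Eq.trans ?_ (congrArg₂ (fun a b : ℂ × ℂ => a * b) (hL u) (hL v)).symm
      simp only [planarBilin_apply]
      ext <;> simp <;> ring)
  rwa [map_zero] at h

end Models

theorem TangentMul.IsFManifold.unit_ne_zero {E : Type*} [NormedAddCommGroup E]
    [NormedSpace ℂ E] {M : Type*} [TopologicalSpace M] [ChartedSpace E M] [IsManifold 𝓘(ℂ, E) ω M]
    {A : TangentMul 𝓘(ℂ, E) M} (hA : A.IsFManifold) (p : M) : A.unit p ≠ 0 := by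
  intro h
  have := Module.nontrivial_of_finrank_pos hA.dim_pos
  obtain ⟨v, hv⟩ := exists_ne (0 : E)
  refine hv ?_
  have h1 := hA.unit_mul p v
  rw [h, map_zero] at h1
  exact h1.symm

/-! ### Coordinates on a plane F-manifold adapted to its unit field. -/

section AdaptedCharts

open Set Filter VectorField

variable {M : Type*} [TopologicalSpace M] [ChartedSpace (ℂ × ℂ) M]

theorem inverse_mfderiv_symm {ψ : OpenPartialHomeomorph M (ℂ × ℂ)}
    (h : ψ.MDifferentiable 𝓘(ℂ, ℂ × ℂ) 𝓘(ℂ, ℂ × ℂ))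
    {z : ℂ × ℂ} (hz : z ∈ ψ.target) :
    (mfderiv 𝓘(ℂ, ℂ × ℂ) 𝓘(ℂ, ℂ × ℂ) ψ.symm z).inverse = mfderiv 𝓘(ℂ, ℂ × ℂ) 𝓘(ℂ, ℂ × ℂ) ψ
        (ψ.symm z) := by
  refine ContinuousLinearMap.inverse_eq ?_ ?_
  · have := h.symm_comp_deriv (ψ.map_target hz)
    rw [ψ.right_inv hz] at this
    exact this
  · exact h.comp_symm_deriv hz

theorem isInvertible_mfderiv_symm {ψ : OpenPartialHomeomorph M (ℂ × ℂ)}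
    (h : ψ.MDifferentiable 𝓘(ℂ, ℂ × ℂ) 𝓘(ℂ, ℂ × ℂ)) {z : ℂ × ℂ} (hz : z ∈ ψ.target) :
    (mfderiv 𝓘(ℂ, ℂ × ℂ) 𝓘(ℂ, ℂ × ℂ) ψ.symm z).IsInvertible :=
  ⟨h.symm.mfderiv hz, rfl⟩

theorem isInvertible_mfderiv {ψ : OpenPartialHomeomorph M (ℂ × ℂ)}
    (h : ψ.MDifferentiable 𝓘(ℂ, ℂ × ℂ) 𝓘(ℂ, ℂ × ℂ)) {q : M} (hq : q ∈ ψ.source) :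
    (mfderiv 𝓘(ℂ, ℂ × ℂ) 𝓘(ℂ, ℂ × ℂ) ψ q).IsInvertible :=
  ⟨h.mfderiv hq, rfl⟩

variable [IsManifold 𝓘(ℂ, ℂ × ℂ) ω M]

/-- Holomorphic vector fields have holomorphic coordinate expressions. -/
theorem contDiffOn_mpullback_symm {ψ : OpenPartialHomeomorph M (ℂ × ℂ)}
    (h1 : ContMDiffOn 𝓘(ℂ, ℂ × ℂ) 𝓘(ℂ, ℂ × ℂ) ω ψ ψ.source)
        (h2 : ContMDiffOn 𝓘(ℂ, ℂ × ℂ) 𝓘(ℂ, ℂ × ℂ) ω ψ.symm ψ.target)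
    {X : ∀ q : M, TangentSpace 𝓘(ℂ, ℂ × ℂ) q} (hX : HolomorphicOn X ψ.source) :
    ContDiffOn ℂ ω (fun z => (mpullback 𝓘(ℂ, ℂ × ℂ) 𝓘(ℂ, ℂ × ℂ) ψ.symm X z : ℂ × ℂ)) ψ.target := by
  have : IsManifold 𝓘(ℂ, ℂ × ℂ) 1 M := IsManifold.of_le (n := ω) le_top
  refine holomorphicOn_plane_iff.1 fun z hz => ContMDiffAt.contMDiffWithinAt ?_
  have hd := openPartialHomeomorph_mdifferentiable h1 h2
  exact ContMDiffAt.mpullback_vectorField_preimage (n := ω)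
    ((hX _ (ψ.map_target hz)).contMDiffAt (ψ.open_source.mem_nhds (ψ.map_target hz)))
    (h2.contMDiffAt (ψ.open_target.mem_nhds hz)) (isInvertible_mfderiv_symm hd hz) (by simp)

theorem holomorphicOn_mpullback {ψ : OpenPartialHomeomorph M (ℂ × ℂ)}
    (h1 : ContMDiffOn 𝓘(ℂ, ℂ × ℂ) 𝓘(ℂ, ℂ × ℂ) ω ψ ψ.source)
        (h2 : ContMDiffOn 𝓘(ℂ, ℂ × ℂ) 𝓘(ℂ, ℂ × ℂ) ω ψ.symm ψ.target)
    {Y : ℂ × ℂ → ℂ × ℂ} (hY : ContDiffOn ℂ ω Y ψ.target) :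
    HolomorphicOn (I := 𝓘(ℂ, ℂ × ℂ)) (mpullback 𝓘(ℂ, ℂ × ℂ) 𝓘(ℂ, ℂ × ℂ) ψ Y) ψ.source := by
  have : IsManifold 𝓘(ℂ, ℂ × ℂ) 1 M := IsManifold.of_le (n := ω) le_top
  intro q hq
  refine ContMDiffAt.contMDiffWithinAt ?_
  have hd := openPartialHomeomorph_mdifferentiable h1 h2
  have hY' : HolomorphicOn (I := 𝓘(ℂ, ℂ × ℂ)) Y ψ.target := holomorphicOn_plane_iff.2 hY
  exact ContMDiffAt.mpullback_vectorField_preimage (n := ω)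
    ((hY' _ (ψ.map_source hq)).contMDiffAt (ψ.open_target.mem_nhds (ψ.map_source hq)))
    (h1.contMDiffAt (ψ.open_source.mem_nhds hq)) (isInvertible_mfderiv hd hq) (by simp)

theorem mlieBracket_mpullback {ψ : OpenPartialHomeomorph M (ℂ × ℂ)}
    (h1 : ContMDiffOn 𝓘(ℂ, ℂ × ℂ) 𝓘(ℂ, ℂ × ℂ) ω ψ ψ.source) {Y Z : ℂ × ℂ → ℂ × ℂ}
        (hY : ContDiffOn ℂ ω Y ψ.target)
    (hZ : ContDiffOn ℂ ω Z ψ.target) {q : M} (hq : q ∈ ψ.source) :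
    mlieBracket 𝓘(ℂ, ℂ × ℂ) (mpullback 𝓘(ℂ, ℂ × ℂ) 𝓘(ℂ, ℂ × ℂ) ψ Y)
        (mpullback 𝓘(ℂ, ℂ × ℂ) 𝓘(ℂ, ℂ × ℂ) ψ Z) q
      = (mfderiv 𝓘(ℂ, ℂ × ℂ) 𝓘(ℂ, ℂ × ℂ) ψ q).inverse
        (fderiv ℂ Z (ψ q) (Y (ψ q)) - fderiv ℂ Y (ψ q) (Z (ψ q)) : ℂ × ℂ) := by
  have : IsManifold 𝓘(ℂ, ℂ × ℂ) (minSmoothness ℂ 3) M := IsManifold.of_le (n := ω) le_top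
  have hd : ∀ {Y : ℂ × ℂ → ℂ × ℂ}, ContDiffOn ℂ ω Y ψ.target →
      MDifferentiableAt 𝓘(ℂ, ℂ × ℂ) (𝓘(ℂ, ℂ × ℂ)).tangent
          (fun z => (⟨z, Y z⟩ : TangentBundle 𝓘(ℂ, ℂ × ℂ) (ℂ × ℂ))) (ψ q) :=
    fun h => (((holomorphicOn_plane_iff.2 h) _ (ψ.map_source hq)).contMDiffAt
      (ψ.open_target.mem_nhds (ψ.map_source hq))).mdifferentiableAt (by simp)
  rw [← mlieBracket_plane]
  exact (mpullback_mlieBracket (n := ω) (hd hY) (hd hZ)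
    (h1.contMDiffAt (ψ.open_source.mem_nhds hq)) le_top).symm

namespace TangentMul

/-- There are coordinates in which the unit field is the first coordinate field. -/
theorem IsFManifold.exists_chart_unit {A : TangentMul 𝓘(ℂ, ℂ × ℂ) M} (hA : A.IsFManifold) (p : M) :
    ∃ ψ : OpenPartialHomeomorph M (ℂ × ℂ), p ∈ ψ.source ∧ ψ p = 0 ∧
      ContMDiffOn 𝓘(ℂ, ℂ × ℂ) 𝓘(ℂ, ℂ × ℂ) ω ψ ψ.source ∧ ContMDiffOn 𝓘(ℂ, ℂ × ℂ) 𝓘(ℂ, ℂ × ℂ) ω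
          ψ.symm ψ.target ∧
      ∀ q ∈ ψ.source, mfderiv 𝓘(ℂ, ℂ × ℂ) 𝓘(ℂ, ℂ × ℂ) ψ q (A.unit q) = ((1, 0) : ℂ × ℂ) := by
  let φ := chartAt (ℂ × ℂ) p
  have hp : p ∈ φ.source := mem_chart_source _ p
  have h1 : ContMDiffOn 𝓘(ℂ, ℂ × ℂ) 𝓘(ℂ, ℂ × ℂ) ω φ φ.source := contMDiffOn_chart
  have h2 : ContMDiffOn 𝓘(ℂ, ℂ × ℂ) 𝓘(ℂ, ℂ × ℂ) ω φ.symm φ.target := contMDiffOn_chart_symm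
  have hd := openPartialHomeomorph_mdifferentiable h1 h2
  let e : ℂ × ℂ → ℂ × ℂ := fun z => mpullback 𝓘(ℂ, ℂ × ℂ) 𝓘(ℂ, ℂ × ℂ) φ.symm A.unit z
  have he : ∀ q ∈ φ.source, e (φ q) = mfderiv 𝓘(ℂ, ℂ × ℂ) 𝓘(ℂ, ℂ × ℂ) φ q (A.unit q) := by
    intro q hq
    change (mfderiv 𝓘(ℂ, ℂ × ℂ) 𝓘(ℂ, ℂ × ℂ) φ.symm (φ q)).inverse (A.unit (φ.symm (φ q))) = _
    rw [inverse_mfderiv_symm hd (φ.map_source hq), φ.left_inv hq]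
  have hea : AnalyticAt ℂ e (φ p) :=
    ((contDiffOn_mpullback_symm h1 h2 (hA.holomorphic_unit.mono (subset_univ _))).contDiffAt
      (φ.open_target.mem_nhds (φ.map_source hp))).analyticAt
  have hep : e (φ p) ≠ 0 := by
    rw [he p hp]
    intro h
    exact hA.unit_ne_zero p ((hd.mfderiv hp).injective (h.trans (map_zero _).symm))
  obtain ⟨Φ, hΦ, hΦ0, hinj, hΦe⟩ := exists_straightening hea hep
  obtain ⟨Θ, hΘp, rfl, hW, h1', h2'⟩ := exists_openPartialHomeomorph hΦ hinj hΦe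
  have hm1' := contMDiffOn_iff_contDiffOn.2 h1'
  have hm2' := contMDiffOn_iff_contDiffOn.2 h2'
  have hd' := openPartialHomeomorph_mdifferentiable hm1' hm2'
  refine ⟨φ.trans Θ, ?_, hΦ0, ?_, ?_, ?_⟩
  · rw [φ.trans_source]
    exact ⟨hp, hΘp⟩
  · rw [φ.trans_source]
    exact hm1'.comp (h1.mono inter_subset_left) fun q hq => hq.2
  · rw [φ.trans_target]
    exact h2.comp (hm2'.mono inter_subset_left) fun q hq => hq.2
  · intro q hq
    rw [φ.trans_source] at hq
    have hc : mfderiv 𝓘(ℂ, ℂ × ℂ) 𝓘(ℂ, ℂ × ℂ) (φ.trans Θ) q =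
        (mfderiv 𝓘(ℂ, ℂ × ℂ) 𝓘(ℂ, ℂ × ℂ) Θ (φ q)).comp (mfderiv 𝓘(ℂ, ℂ × ℂ) 𝓘(ℂ, ℂ × ℂ) φ q) :=
      mfderiv_comp q (hd'.mdifferentiableAt hq.2) (hd.mdifferentiableAt hq.1)
    have h3 : fderiv ℂ Θ (φ q) (e (φ q)) = (1, 0) := hW hq.2
    rw [hc, mfderiv_eq_fderiv]
    rw [he q hq.1] at h3
    exact h3

end TangentMul

/-- The bilinear product on `ℂ²` with unit `(1, 0)` and `(0, 1) ∘ (0, 1) = c`. -/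
noncomputable def planarBilinOfSq (c : ℂ × ℂ) : ℂ × ℂ →ₗ[ℂ] ℂ × ℂ →ₗ[ℂ] ℂ × ℂ :=
  LinearMap.mk₂ ℂ
    (fun u v =>
      (u.1 * v.1 + c.1 * (u.2 * v.2), u.1 * v.2 + u.2 * v.1 + c.2 * (u.2 * v.2)))
    (fun _ _ _ => by ext <;> simp <;> ring)
    (fun _ _ _ => by ext <;> simp <;> ring)
    (fun _ _ _ => by ext <;> simp <;> ring)
    (fun _ _ _ => by ext <;> simp <;> ring)

theorem planarBilinOfSq_apply (c u v : ℂ × ℂ) : planarBilinOfSq c u v =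
    (u.1 * v.1 + c.1 * (u.2 * v.2), u.1 * v.2 + u.2 * v.1 + c.2 * (u.2 * v.2)) := rfl

/-- The multiplication on `T ℂ²` with unit field `∂₁` and `∂₂ ∘ ∂₂ = m₁ ∂₁ + m₂ ∂₂`. -/
noncomputable def planarMulOfSq (m : ℂ × ℂ → ℂ × ℂ) : TangentMul 𝓘(ℂ, ℂ × ℂ) (ℂ × ℂ) where
  mul t := planarBilinOfSq (m t)
  unit _ := ((1, 0) : ℂ × ℂ)

namespace TangentMul

/-- Every germ of a plane F-manifold has coordinates in which `e = ∂₁` and the coefficients of the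
multiplication do not depend on the first coordinate. -/
theorem IsFManifold.exists_germIso_planarMulOfSq {A : TangentMul 𝓘(ℂ, ℂ × ℂ) M} (hA : A.IsFManifold)
    (p : M) :
    ∃ m : ℂ × ℂ → ℂ × ℂ, AnalyticAt ℂ m 0 ∧ (∀ᶠ z in 𝓝 0, fderiv ℂ m z (1, 0) = 0) ∧
      GermIso A p (planarMulOfSq m) (0 : ℂ × ℂ) := by
  obtain ⟨ψ, hp, hp0, h1, h2, hunit⟩ := hA.exists_chart_unit p
  have hd := openPartialHomeomorph_mdifferentiable h1 h2
  let V : ∀ q : M, TangentSpace 𝓘(ℂ, ℂ × ℂ) q := mpullback 𝓘(ℂ, ℂ × ℂ) 𝓘(ℂ, ℂ × ℂ) ψ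
      (fun _ : ℂ × ℂ => ((0, 1) : ℂ × ℂ))
  have hV : HolomorphicOn V ψ.source := holomorphicOn_mpullback h1 h2 contDiffOn_const
  have hinv : ∀ q ∈ ψ.source, ∀ u : TangentSpace 𝓘(ℂ, ℂ × ℂ) q,
      (mfderiv 𝓘(ℂ, ℂ × ℂ) 𝓘(ℂ, ℂ × ℂ) ψ q).inverse (mfderiv 𝓘(ℂ, ℂ × ℂ) 𝓘(ℂ, ℂ × ℂ) ψ q u) = u :=
          by
    intro q hq u
    have h := (isInvertible_mfderiv hd hq).inverse_comp_self
    exact congrArg (fun f => f u) h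
  have hinv' : ∀ q ∈ ψ.source, ∀ u : ℂ × ℂ,
      mfderiv 𝓘(ℂ, ℂ × ℂ) 𝓘(ℂ, ℂ × ℂ) ψ q ((mfderiv 𝓘(ℂ, ℂ × ℂ) 𝓘(ℂ, ℂ × ℂ) ψ q).inverse u) = u :=
          by
    intro q hq u
    have h := (isInvertible_mfderiv hd hq).self_comp_inverse
    exact congrArg (fun f => f u) h
  have hdV : ∀ q ∈ ψ.source, mfderiv 𝓘(ℂ, ℂ × ℂ) 𝓘(ℂ, ℂ × ℂ) ψ q (V q) = ((0, 1) : ℂ × ℂ) := fun q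
      hq =>
    hinv' q hq _
  have hVV : HolomorphicOn (A.mulField V V) ψ.source :=
    hA.holomorphic_mul _ ψ.open_source V V hV hV
  let m : ℂ × ℂ → ℂ × ℂ := fun z => mpullback 𝓘(ℂ, ℂ × ℂ) 𝓘(ℂ, ℂ × ℂ) ψ.symm (A.mulField V V) z
  have hm : ContDiffOn ℂ ω m ψ.target := contDiffOn_mpullback_symm h1 h2 hVV
  have hmq : ∀ q ∈ ψ.source, mfderiv 𝓘(ℂ, ℂ × ℂ) 𝓘(ℂ, ℂ × ℂ) ψ q (A.mul q (V q) (V q)) = m (ψ q) :=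
      by
    intro q hq
    change _ = (mfderiv 𝓘(ℂ, ℂ × ℂ) 𝓘(ℂ, ℂ × ℂ) ψ.symm (ψ q)).inverse
        (A.mulField V V (ψ.symm (ψ q)))
    rw [inverse_mfderiv_symm hd (ψ.map_source hq), ψ.left_inv hq]
    rfl
  have h0 : (0 : ℂ × ℂ) ∈ ψ.target := hp0 ▸ ψ.map_source hp
  have hue : ∀ q ∈ ψ.source,
      A.unit =ᶠ[𝓝 q] mpullback 𝓘(ℂ, ℂ × ℂ) 𝓘(ℂ, ℂ × ℂ) ψ (fun _ : ℂ × ℂ => ((1, 0) : ℂ × ℂ)) := by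
    intro q hq
    filter_upwards [ψ.open_source.mem_nhds hq] with x hx
    change _ = (mfderiv 𝓘(ℂ, ℂ × ℂ) 𝓘(ℂ, ℂ × ℂ) ψ x).inverse ((1, 0) : ℂ × ℂ)
    rw [← hunit x hx, hinv x hx]
  have hVe : ∀ q ∈ ψ.source, A.mulField V V =ᶠ[𝓝 q] mpullback 𝓘(ℂ, ℂ × ℂ) 𝓘(ℂ, ℂ × ℂ) ψ m := by
    intro q hq
    filter_upwards [ψ.open_source.mem_nhds hq] with x hx
    change A.mul x (V x) (V x) = (mfderiv 𝓘(ℂ, ℂ × ℂ) 𝓘(ℂ, ℂ × ℂ) ψ x).inverse (m (ψ x))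
    rw [← hmq x hx, hinv x hx]
  have hder : ∀ z ∈ ψ.target, fderiv ℂ m z (1, 0) = 0 := by
    intro z hz
    obtain ⟨q, hq, rfl⟩ : ∃ q ∈ ψ.source, ψ q = z := ⟨ψ.symm z, ψ.map_target hz, ψ.right_inv hz⟩
    -- In the chart `e` and `V` are the constant fields `∂₁` and `∂₂`, so they commute.
    have hb1 : mlieBracket 𝓘(ℂ, ℂ × ℂ) A.unit V q = 0 := by
      refine ((hue q hq).mlieBracket_vectorField_eq EventuallyEq.rfl).trans
        ((mlieBracket_mpullback h1 contDiffOn_const contDiffOn_const hq).trans ?_)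
      rw [fderiv_const_apply, fderiv_const_apply]
      exact (congrArg _ (by simp; rfl)).trans (map_zero _)
    have hb2 : mlieBracket 𝓘(ℂ, ℂ × ℂ) A.unit (A.mulField V V) q
        = (mfderiv 𝓘(ℂ, ℂ × ℂ) 𝓘(ℂ, ℂ × ℂ) ψ q).inverse (fderiv ℂ m (ψ q) (1, 0) : ℂ × ℂ) := by
      refine ((hue q hq).mlieBracket_vectorField_eq (hVe q hq)).trans
        ((mlieBracket_mpullback h1 contDiffOn_const hm hq).trans ?_)
      rw [fderiv_const_apply]
      exact congrArg _ (by simp)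
    -- The F-manifold identity for `e = e ∘ e` gives `Lie_e(∘) = 2 Lie_e(∘)`, so `Lie_e(∘) = 0`.
    -- With `[e, V] = 0` this leaves `[e, V ∘ V] = 0`, that is, `∂₁ m = 0`.
    have hee : A.mulField A.unit A.unit = A.unit := funext fun x => hA.unit_mul x _
    have hu := hA.holomorphic_unit.mono (subset_univ ψ.source)
    have h3 := hA.lie_mul ψ.source ψ.open_source A.unit A.unit V V hu hu hV hV q hq
    rw [hee, hA.unit_mul] at h3
    have h4 : A.lieMul A.unit V V q = 0 := by simpa using h3
    rw [TangentMul.lieMul, hb1, hb2] at h4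
    simp only [map_zero, LinearMap.zero_apply, sub_zero] at h4
    have h5 := congrArg (mfderiv 𝓘(ℂ, ℂ × ℂ) 𝓘(ℂ, ℂ × ℂ) ψ q) h4
    rw [hinv' q hq, map_zero] at h5
    exact h5
  refine ⟨m, (hm.contDiffAt (ψ.open_target.mem_nhds h0)).analyticAt, ?_, ψ, hp, hp0, h1, h2, ?_⟩
  · filter_upwards [ψ.open_target.mem_nhds h0] with z hz using hder z hz
  · intro q hq
    refine ⟨hunit q hq, fun u v => ?_⟩
    have hdec : ∀ u : TangentSpace 𝓘(ℂ, ℂ × ℂ) q, ∀ w : ℂ × ℂ, mfderiv 𝓘(ℂ, ℂ × ℂ) 𝓘(ℂ, ℂ × ℂ) ψ q u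
        = w →
        u = w.1 • A.unit q + w.2 • V q := by
      rintro u w hw
      refine (hd.mfderiv hq).injective ?_
      change mfderiv 𝓘(ℂ, ℂ × ℂ) 𝓘(ℂ, ℂ × ℂ) ψ q u = mfderiv 𝓘(ℂ, ℂ × ℂ) 𝓘(ℂ, ℂ × ℂ) ψ q _
      rw [map_add, map_smul, map_smul, hunit q hq, hdV q hq, hw]
      refine (Prod.ext ?_ ?_ : w = w.1 • ((1, 0) : ℂ × ℂ) + w.2 • ((0, 1) : ℂ × ℂ)) <;> simp
    obtain ⟨u', hu'⟩ : ∃ w : ℂ × ℂ, mfderiv 𝓘(ℂ, ℂ × ℂ) 𝓘(ℂ, ℂ × ℂ) ψ q u = w := ⟨_, rfl⟩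
    obtain ⟨v', hv'⟩ : ∃ w : ℂ × ℂ, mfderiv 𝓘(ℂ, ℂ × ℂ) 𝓘(ℂ, ℂ × ℂ) ψ q v = w := ⟨_, rfl⟩
    rw [hu', hv', hdec u u' hu', hdec v v' hv']
    simp only [map_add, LinearMap.add_apply, map_smul, LinearMap.smul_apply, hA.unit_mul,
      hA.mul_comm q (V q) (A.unit q), hmq q hq]
    rw [hunit q hq, hdV q hq]
    have key : ∀ c : ℂ × ℂ, v'.1 • (u'.1 • ((1, 0) : ℂ × ℂ) + u'.2 • ((0, 1) : ℂ × ℂ))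
        + v'.2 • (u'.1 • ((0, 1) : ℂ × ℂ) + u'.2 • c) = planarBilinOfSq c u' v' := by
      intro c
      rw [planarBilinOfSq_apply]
      ext <;> simp <;> ring
    exact key _

end TangentMul

end AdaptedCharts

/-! ### Normal form of a quadratic differential in one variable. -/

section OneVariable

open Set Filter Metric MeasureTheory

/-- Analytic `n`-th roots of nonvanishing germs. -/
theorem exists_analytic_root {h : ℂ → ℂ} {z₀ : ℂ} (hh : AnalyticAt ℂ h z₀) (h0 : h z₀ ≠ 0) {n : ℕ}
    (hn : 0 < n) : ∃ r : ℂ → ℂ, AnalyticAt ℂ r z₀ ∧ r z₀ ≠ 0 ∧ ∀ᶠ z in 𝓝 z₀, r z ^ n = h z := by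
  obtain ⟨c, hc⟩ := IsAlgClosed.exists_pow_nat_eq (h z₀) hn
  have hn0 : (n : ℂ) ≠ 0 := by exact_mod_cast hn.ne'
  have hc0 : c ≠ 0 := by
    rintro rfl
    exact h0 (by rw [← hc, zero_pow hn.ne'])
  have hq : AnalyticAt ℂ (fun z => h z / h z₀) z₀ := hh.div analyticAt_const h0
  have hl : AnalyticAt ℂ (fun z => Complex.log (h z / h z₀)) z₀ :=
    hq.clog (by rw [div_self h0]; exact Complex.one_mem_slitPlane)
  have hl' : AnalyticAt ℂ (fun z => Complex.log (h z / h z₀) / n) z₀ :=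
    hl.div analyticAt_const hn0
  refine ⟨fun z => c * Complex.exp (Complex.log (h z / h z₀) / n),
    analyticAt_const.mul hl'.cexp, mul_ne_zero hc0 (Complex.exp_ne_zero _), ?_⟩
  filter_upwards [hh.continuousAt.eventually_ne h0] with z hz
  rw [mul_pow, hc, ← Complex.exp_nat_mul, mul_div_cancel₀ _ hn0,
    Complex.exp_log (div_ne_zero hz h0), mul_div_cancel₀ _ h0]

/-- A regular singular linear equation of first order with holomorphic solution. -/
theorem exists_solution_mul_add_mul_deriv {s : ℂ → ℂ} (hs : AnalyticAt ℂ s 0) (k : ℕ) :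
    ∃ g : ℂ → ℂ, AnalyticAt ℂ g 0 ∧
      ∀ᶠ z in 𝓝 (0 : ℂ), (k + 1) * g z + 2 * (z * deriv g z) = s z := by
  obtain ⟨R, hR, hball⟩ := Metric.eventually_nhds_iff_ball.1 hs.eventually_analyticAt
  set r := R / 2 with hr
  have hr0 : 0 < r := by positivity
  have hsub : closedBall (0 : ℂ) r ⊆ ball 0 R := closedBall_subset_ball (by linarith)
  have hsa : AnalyticOnNhd ℂ s (closedBall 0 r) := fun z hz => hball z (hsub hz)
  obtain ⟨C, hC⟩ := (isCompact_closedBall (0 : ℂ) r).exists_bound_of_continuousOn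
    (hsa.deriv.continuousOn)
  have hmem : ∀ z ∈ ball (0 : ℂ) r, ∀ σ ∈ Icc (0 : ℝ) 1, ((σ : ℂ) ^ 2 * z) ∈ closedBall (0 : ℂ) r :=
      by
    intro z hz σ hσ
    rw [mem_ball_zero_iff] at hz
    rw [mem_closedBall_zero_iff, norm_mul, norm_pow, Complex.norm_real, Real.norm_eq_abs, sq_abs]
    nlinarith [norm_nonneg z, hσ.1, hσ.2, mul_nonneg hσ.1 (sub_nonneg.2 hσ.2)]
  have huIoc : uIoc (0 : ℝ) 1 ⊆ Icc 0 1 := by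
    rw [uIoc_of_le zero_le_one]
    exact Ioc_subset_Icc_self
  have huIcc : uIcc (0 : ℝ) 1 = Icc 0 1 := uIcc_of_le zero_le_one
  -- The solution is `g(z) = ∫₀¹ σ^k s(σ² z) dσ`: the integrand `(k + 1) F + 2 z F'` is the
  -- `σ`-derivative of `σ^(k+1) s(σ² z)`, whose boundary values are `s(z)` and `0`.
  let F : ℂ → ℝ → ℂ := fun z σ => (σ : ℂ) ^ k * s ((σ : ℂ) ^ 2 * z)
  let F' : ℂ → ℝ → ℂ := fun z σ => (σ : ℂ) ^ (k + 2) * deriv s ((σ : ℂ) ^ 2 * z)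
  have hFc : ∀ z ∈ ball (0 : ℂ) r, ContinuousOn (F z) (Icc 0 1) := fun z hz =>
    ContinuousOn.mul (by fun_prop) (hsa.continuousOn.comp (by fun_prop) (hmem z hz))
  have hF'c : ∀ z ∈ ball (0 : ℂ) r, ContinuousOn (F' z) (Icc 0 1) := fun z hz =>
    ContinuousOn.mul (by fun_prop) (hsa.deriv.continuousOn.comp (by fun_prop) (hmem z hz))
  have hFi : ∀ z ∈ ball (0 : ℂ) r, IntervalIntegrable (F z) volume 0 1 := fun z hz =>
    ContinuousOn.intervalIntegrable (by rw [huIcc]; exact hFc z hz)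
  have hF'i : ∀ z ∈ ball (0 : ℂ) r, IntervalIntegrable (F' z) volume 0 1 := fun z hz =>
    ContinuousOn.intervalIntegrable (by rw [huIcc]; exact hF'c z hz)
  let g : ℂ → ℂ := fun z => ∫ σ in (0 : ℝ)..1, F z σ
  have hg : ∀ z ∈ ball (0 : ℂ) r, HasDerivAt g (∫ σ in (0 : ℝ)..1, F' z σ) z := by
    intro z hz
    refine (intervalIntegral.hasDerivAt_integral_of_dominated_loc_of_deriv_le (bound := fun _ => C)
      (isOpen_ball.mem_nhds hz) ?_ (hFi z hz) ?_ ?_ intervalIntegrable_const ?_).2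
    · filter_upwards [isOpen_ball.mem_nhds hz] with w hw
      exact (hFi w hw).def'.aestronglyMeasurable
    · exact (hF'i z hz).def'.aestronglyMeasurable
    · refine Eventually.of_forall fun σ hσ w hw => ?_
      have h1 := hC _ (hmem w hw σ (huIoc hσ))
      have h2 : ‖(σ : ℂ) ^ (k + 2)‖ ≤ 1 := by
        rw [norm_pow, Complex.norm_real, Real.norm_eq_abs, abs_of_nonneg (huIoc hσ).1]
        exact pow_le_one₀ (huIoc hσ).1 (huIoc hσ).2
      rw [norm_mul]
      exact (mul_le_of_le_one_left (norm_nonneg _) h2).trans h1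
    · refine Eventually.of_forall fun σ hσ w hw => ?_
      have h1 := (hsa _ (hmem w hw σ (huIoc hσ))).differentiableAt.hasDerivAt
      have h2 : HasDerivAt (fun w : ℂ => (σ : ℂ) ^ 2 * w) ((σ : ℂ) ^ 2) w := by
        simpa using (hasDerivAt_id w).const_mul ((σ : ℂ) ^ 2)
      have h3 : HasDerivAt (fun w => F w σ) _ w := (h1.comp w h2).const_mul ((σ : ℂ) ^ k)
      refine h3.congr_deriv ?_
      simp only [F']
      ring
  have hgd : DifferentiableOn ℂ g (ball 0 r) := fun z hz =>
    (hg z hz).differentiableAt.differentiableWithinAt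
  refine ⟨g, hgd.analyticAt (ball_mem_nhds 0 hr0), ?_⟩
  filter_upwards [ball_mem_nhds (0 : ℂ) hr0] with z hz
  rw [(hg z hz).deriv]
  have hftc : ∫ σ in (0 : ℝ)..1, ((k + 1) * F z σ + 2 * (z * F' z σ))
      = (1 : ℝ) ^ (k + 1) * s (((1 : ℝ) : ℂ) ^ 2 * z)
        - ((0 : ℝ) : ℂ) ^ (k + 1) * s (((0 : ℝ) : ℂ) ^ 2 * z) := by
    refine intervalIntegral.integral_eq_sub_of_hasDerivAt
      (f := fun σ : ℝ => (σ : ℂ) ^ (k + 1) * s ((σ : ℂ) ^ 2 * z)) ?_ ?_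
    · intro σ hσ
      rw [huIcc] at hσ
      have h1 := (hsa _ (hmem z hz σ hσ)).differentiableAt.hasDerivAt
      have h2 : HasDerivAt (fun σ : ℝ => (σ : ℂ)) 1 σ := Complex.ofRealCLM.hasDerivAt
      have h3 := (h2.pow 2).mul_const z
      have h4 : HasDerivAt (fun σ : ℝ => (σ : ℂ) ^ (k + 1) * s ((σ : ℂ) ^ 2 * z)) _ σ :=
        (h2.pow (k + 1)).mul (h1.comp σ h3)
      refine h4.congr_deriv ?_
      simp [F, F']
      ring
    · exact ((hFi z hz).const_mul _).add (((hF'i z hz).const_mul _).const_mul _)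
  rw [intervalIntegral.integral_add ((hFi z hz).const_mul _)
    (((hF'i z hz).const_mul _).const_mul _), intervalIntegral.integral_const_mul,
    intervalIntegral.integral_const_mul, intervalIntegral.integral_const_mul] at hftc
  simpa using hftc

/-- Quadratic differentials `f (dz)²` of one variable have the normal form `Y ^ k (dY)²`. -/
theorem exists_coordinate_pow_mul_deriv_sq {f : ℂ → ℂ} (hf : AnalyticAt ℂ f 0)
    (h0 : ¬ ∀ᶠ z in 𝓝 0, f z = 0) : ∃ (k : ℕ) (Y : ℂ → ℂ), AnalyticAt ℂ Y 0 ∧ Y 0 = 0 ∧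
      deriv Y 0 ≠ 0 ∧ ∀ᶠ z in 𝓝 0, Y z ^ k * deriv Y z ^ 2 = f z := by
  obtain ⟨k, u, hu, hu0, hfu⟩ := hf.exists_eventuallyEq_pow_smul_nonzero_iff.2 h0
  obtain ⟨s, hs, hs0, hsu⟩ := exists_analytic_root hu hu0 two_pos
  -- With `f = z^k s²` the goal is formally `Y^(k/2) Y' = z^(k/2) s`. Integrating gives `Y^((k+2)/2)
  -- = (k+2) z^((k+2)/2) g`, where `(k+2) g + 2 z g' = s`. Squaring removes the half-integral
  -- powers: `Y = z r` with `r^(k+2) = ((k+2) g)²`.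
  obtain ⟨g, hg, hgs⟩ := exists_solution_mul_add_mul_deriv hs (k + 1)
  have hk2 : ((k + 2 : ℕ) : ℂ) ≠ 0 := by exact_mod_cast (by omega : k + 2 ≠ 0)
  have hg0 : g 0 ≠ 0 := by
    have h1 := hgs.self_of_nhds
    intro h
    rw [h] at h1
    exact hs0 (by simpa using h1.symm)
  have hh : AnalyticAt ℂ (fun z => (((k + 2 : ℕ) : ℂ) * g z) ^ 2) 0 := (analyticAt_const.mul hg).pow
      2
  obtain ⟨r, hr, hr0, hrh⟩ := exists_analytic_root hh (pow_ne_zero 2 (mul_ne_zero hk2 hg0))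
    (by omega : 0 < k + 2)
  have hY : AnalyticAt ℂ (fun z => z * r z) 0 := analyticAt_id.mul hr
  refine ⟨k, fun z => z * r z, hY, by simp, ?_, ?_⟩
  · have h1 : HasDerivAt (fun z => z * r z) (1 * r 0 + 0 * deriv r 0) 0 :=
      (hasDerivAt_id 0).mul hr.differentiableAt.hasDerivAt
    rw [h1.deriv]
    simpa using hr0
  -- By the identity theorem it suffices to work at `z ≠ 0`, where a power of `Y` can be cancelled.
  · refine ((((hY.pow k).mul (hY.deriv.pow 2)).frequently_eq_iff_eventually_eq hf).1 ?_)
    refine Eventually.frequently ?_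
    have hEv : ∀ᶠ z in 𝓝 (0 : ℂ), (f z = (z - 0) ^ k • u z) ∧ (s z ^ 2 = u z) ∧
        (((k + 1 : ℕ) : ℂ) + 1) * g z + 2 * (z * deriv g z) = s z ∧ r z ≠ 0 ∧
        AnalyticAt ℂ g z ∧ AnalyticAt ℂ r z ∧
        ∀ᶠ w in 𝓝 z, r w ^ (k + 2) = (((k + 2 : ℕ) : ℂ) * g w) ^ 2 := by
      filter_upwards [hfu, hsu, hgs, hr.continuousAt.eventually_ne hr0, hg.eventually_analyticAt,
        hr.eventually_analyticAt, hrh.eventually_nhds] with z h1 h2 h3 h4 h5 h6 h7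
      exact ⟨h1, h2, h3, h4, h5, h6, h7⟩
    filter_upwards [nhdsWithin_le_nhds hEv, self_mem_nhdsWithin] with z hz hz0
    obtain ⟨h1, h2, h3, h4, h5, h6, h7⟩ := hz
    have hz0 : z ≠ 0 := hz0
    change (z * r z) ^ k * deriv (fun z => z * r z) z ^ 2 = f z
    have hY' : HasDerivAt (fun z => z * r z) (deriv (fun z => z * r z) z) z :=
      (differentiableAt_id.mul h6.differentiableAt).hasDerivAt
    have hP1 := hY'.pow (k + 2)
    have hP2 := ((hasDerivAt_id z).pow (k + 2)).mul
      ((h5.differentiableAt.hasDerivAt.const_mul ((k + 2 : ℕ) : ℂ)).pow 2)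
    have hPeq : (fun w => (w * r w) ^ (k + 2)) =ᶠ[𝓝 z]
        (fun w => w ^ (k + 2) * (((k + 2 : ℕ) : ℂ) * g w) ^ 2) := by
      filter_upwards [h7] with w hw
      rw [mul_pow, hw]
    have hD := (hP1.congr_of_eventuallyEq hPeq.symm).unique hP2
    have hv := hPeq.self_of_nhds
    have hcast : (((k + 1 : ℕ) : ℂ) + 1) = ((k + 2 : ℕ) : ℂ) := by push_cast; ring
    rw [hcast] at h3
    simp only [Pi.pow_apply, id, Nat.cast_ofNat, show k + 2 - 1 = k + 1 from rfl,
      show 2 - 1 = 1 from rfl] at hD hv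
    generalize ((k + 2 : ℕ) : ℂ) = c at *
    generalize deriv (fun z => z * r z) z = y' at *
    have hYne : z * r z ≠ 0 := mul_ne_zero hz0 h4
    -- This is the derivative of `Y^(k+2) = z^(k+2) (c g)²`, simplified by the equation for `g`.
    have hmain : (z * r z) ^ (k + 1) * y' = c * z ^ (k + 1) * g z * s z := by
      refine mul_left_cancel₀ hk2 ?_
      rw [← h3]
      linear_combination hD
    refine mul_left_cancel₀ (pow_ne_zero (k + 2) hYne) ?_
    rw [h1, ← h2, sub_zero, smul_eq_mul]
    calc (z * r z) ^ (k + 2) * ((z * r z) ^ k * y' ^ 2)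
        = ((z * r z) ^ (k + 1) * y') ^ 2 := by ring
      _ = (z ^ (k + 2) * (c * g z) ^ 2) * (z ^ k * s z ^ 2) := by rw [hmain]; ring
      _ = _ := by rw [hv]

end OneVariable

/-! ### Reduction of the multiplication to a model. -/

section NormalForms

open Set Filter Metric

theorem exists_primitive_at_zero {b : ℂ → ℂ} (hb : AnalyticAt ℂ b 0) :
    ∃ φ : ℂ → ℂ, AnalyticAt ℂ φ 0 ∧ φ 0 = 0 ∧ ∀ᶠ z in 𝓝 0, HasDerivAt φ (b z) z := by
  obtain ⟨r, hr, hd⟩ := Metric.eventually_nhds_iff_ball.1 hb.eventually_analyticAt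
  obtain ⟨g, hg⟩ := DifferentiableOn.isExactOn_ball (f := b) (c := (0 : ℂ)) (r := r)
    fun z hz => (hd z hz).differentiableAt.differentiableWithinAt
  have hball : ball (0 : ℂ) r ∈ 𝓝 (0 : ℂ) := ball_mem_nhds 0 hr
  have hga : AnalyticAt ℂ g 0 := DifferentiableOn.analyticAt
    (fun z hz => (hg z hz).differentiableAt.differentiableWithinAt) hball
  refine ⟨fun z => g z - g 0, hga.sub analyticAt_const, sub_self _, ?_⟩
  filter_upwards [hball] with z hz
  exact (hg z hz).sub_const _

/-- Completing the square: `∂₂ - (c₂/2) e` has square `(c₁ + c₂²/4) e`. -/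
theorem planarBilinOfSq_shear (c : ℂ × ℂ) (u v : ℂ × ℂ) :
    let D : ℂ × ℂ → ℂ × ℂ := fun w => (w.1 + c.2 / 2 * w.2, w.2)
    D (planarBilinOfSq c u v) = planarBilin (c.1 + c.2 ^ 2 / 4) (D u) (D v) := by
  intro D
  simp only [D, planarBilinOfSq_apply, planarBilin_apply]
  ext <;> simp <;> ring

theorem analyticAt_comp_snd {f : ℂ → ℂ} {p : ℂ × ℂ} (hf : AnalyticAt ℂ f p.2) :
    AnalyticAt ℂ (fun t : ℂ × ℂ => f t.2) p :=
  AnalyticAt.comp (f := fun t : ℂ × ℂ => t.2) hf analyticAt_snd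

/-- The pointwise shear is the differential of `(t₁ + φ(t₂), t₂)` with `φ' = m₂/2`; such a primitive
exists because `m` does not depend on `t₁`. -/
theorem germIso_planarMulOfSq_planarMul {m : ℂ × ℂ → ℂ × ℂ} (hm : AnalyticAt ℂ m 0)
    (h1 : ∀ᶠ z in 𝓝 0, fderiv ℂ m z (1, 0) = 0) :
    ∃ f : ℂ → ℂ, AnalyticAt ℂ f 0 ∧
      GermIso (planarMulOfSq m) (0 : ℂ × ℂ) (planarMul fun t => f t.2) (0 : ℂ × ℂ) := by
  have hs : AnalyticAt ℂ (fun s : ℂ => m (0, s)) 0 :=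
    AnalyticAt.comp (f := fun s : ℂ => ((0 : ℂ), s)) hm (analyticAt_const.prod analyticAt_id)
  have ha : AnalyticAt ℂ (fun s : ℂ => (m (0, s)).1) 0 := analyticAt_fst.comp hs
  have hb : AnalyticAt ℂ (fun s : ℂ => (m (0, s)).2) 0 := analyticAt_snd.comp hs
  obtain ⟨r, hr, hd⟩ := Metric.eventually_nhds_iff_ball.1 (hm.eventually_analyticAt.and h1)
  have hm0 : ∀ᶠ t in 𝓝 (0 : ℂ × ℂ), m t = m (0, t.2) := by
    filter_upwards [ball_mem_nhds (0 : ℂ × ℂ) hr] with t ht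
    exact eq_of_fderiv_fst_eq_zero
      (fun z hz => (hd z hz).1.differentiableAt.differentiableWithinAt)
      (fun z hz => (hd z hz).2) ht
  obtain ⟨φ, hφ, hφ0, hφd⟩ := exists_primitive_at_zero (hb.div_const (c := 2))
  refine ⟨fun s => (m (0, s)).1 + (m (0, s)).2 ^ 2 / 4, ha.add ((hb.pow 2).div_const), ?_⟩
  have hΦ : AnalyticAt ℂ (fun t : ℂ × ℂ => (t.1 + φ t.2, t.2)) 0 :=
    (analyticAt_fst.add (analyticAt_comp_snd hφ)).prod analyticAt_snd
  have hsnd : Tendsto (fun t : ℂ × ℂ => t.2) (𝓝 0) (𝓝 0) := continuous_snd.tendsto 0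
  have hder : ∀ᶠ t in 𝓝 (0 : ℂ × ℂ), ∀ v : ℂ × ℂ,
      fderiv ℂ (fun t : ℂ × ℂ => (t.1 + φ t.2, t.2)) t v
        = (v.1 + (m (0, t.2)).2 / 2 * v.2, v.2) := by
    filter_upwards [hsnd.eventually hφd] with t ht v
    have h2 : HasFDerivAt (fun t : ℂ × ℂ => t.2) (ContinuousLinearMap.snd ℂ ℂ ℂ) t :=
        hasFDerivAt_snd
    have h3 := ht.comp_hasFDerivAt t h2
    have h4 : HasFDerivAt (fun t : ℂ × ℂ => t.1) (ContinuousLinearMap.fst ℂ ℂ ℂ) t :=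
        hasFDerivAt_fst
    have h5 := (h4.fun_add h3).prodMk h2
    exact congrArg (fun L => L v) h5.fderiv
  have := germIso_of_analyticAt (A := planarMulOfSq m)
    (A' := planarMul fun t => (m (0, t.2)).1 + (m (0, t.2)).2 ^ 2 / 4) hΦ ?_ ?_ ?_
  · have h0 : (((0 : ℂ × ℂ).1 + φ (0 : ℂ × ℂ).2, (0 : ℂ × ℂ).2) : ℂ × ℂ) = 0 := by simp [hφ0]
    rwa [h0] at this
  · intro v hv
    rw [hder.self_of_nhds] at hv
    obtain ⟨h1, h2⟩ := Prod.mk.inj hv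
    rw [h2] at h1
    exact Prod.ext (by simpa using h1) h2
  · filter_upwards [hder] with t ht
    refine (ht (1, 0)).trans ?_
    change _ = ((1, 0) : ℂ × ℂ)
    simp
  · filter_upwards [hder, hm0] with t ht hmt u v
    rw [ht u, ht v]
    refine (ht _).trans ?_
    have hs := planarBilinOfSq_shear (m (0, t.2)) u v
    refine Eq.trans ?_ hs
    change _ = ((planarBilinOfSq (m (0, t.2)) u v).1 + (m (0, t.2)).2 / 2 *
      (planarBilinOfSq (m (0, t.2)) u v).2, (planarBilinOfSq (m (0, t.2)) u v).2)
    rw [← hmt]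
    rfl

theorem germIso_planarMul_nilpotentPlane {f : ℂ → ℂ} (hf : ∀ᶠ z in 𝓝 0, f z = 0) :
    GermIso (planarMul fun t => f t.2) (0 : ℂ × ℂ) nilpotentPlane (0 : ℂ × ℂ) := by
  have hsnd : Tendsto (fun t : ℂ × ℂ => t.2) (𝓝 0) (𝓝 0) := continuous_snd.tendsto 0
  refine germIso_of_analyticAt (Φ := id) analyticAt_id (fun v hv => by simpa using hv) ?_ ?_
  · refine Eventually.of_forall fun t => ?_
    rw [fderiv_id]
    rfl
  · filter_upwards [hsnd.eventually hf] with t ht u v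
    rw [fderiv_id]
    change planarBilin (f t.2) u v = planarBilin 0 u v
    rw [ht]

/-- The map `(t₁, Y(t₂))` sends `∂₂` to `Y' ∂₂`, whose square in the target is `Y^k (Y')² ∂₁ = f
∂₁`. -/
theorem germIso_planarMul_I2 {f : ℂ → ℂ} (hf : AnalyticAt ℂ f 0)
    (h0 : ¬ ∀ᶠ z in 𝓝 0, f z = 0) :
    ∃ k : ℕ, GermIso (planarMul fun t => f t.2) (0 : ℂ × ℂ) (I2 (k + 2)) (0 : ℂ × ℂ) := by
  obtain ⟨k, Y, hY, hY0, hY1, hYf⟩ := exists_coordinate_pow_mul_deriv_sq hf h0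
  refine ⟨k, ?_⟩
  have hΦ : AnalyticAt ℂ (fun t : ℂ × ℂ => (t.1, Y t.2)) 0 :=
    analyticAt_fst.prod (analyticAt_comp_snd hY)
  have hsnd : Tendsto (fun t : ℂ × ℂ => t.2) (𝓝 0) (𝓝 0) := continuous_snd.tendsto 0
  have hder : ∀ᶠ t in 𝓝 (0 : ℂ × ℂ), ∀ v : ℂ × ℂ,
      fderiv ℂ (fun t : ℂ × ℂ => (t.1, Y t.2)) t v = (v.1, deriv Y t.2 * v.2) := by
    filter_upwards [hsnd.eventually hY.eventually_analyticAt] with t ht v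
    have h2 : HasFDerivAt (fun t : ℂ × ℂ => t.2) (ContinuousLinearMap.snd ℂ ℂ ℂ) t :=
        hasFDerivAt_snd
    have h3 := ht.differentiableAt.hasDerivAt.comp_hasFDerivAt t h2
    have h4 : HasFDerivAt (fun t : ℂ × ℂ => t.1) (ContinuousLinearMap.fst ℂ ℂ ℂ) t :=
        hasFDerivAt_fst
    exact congrArg (fun L => L v) (h4.prodMk h3).fderiv
  have := germIso_of_analyticAt (A := planarMul fun t => f t.2) (A' := I2 (k + 2)) hΦ ?_ ?_ ?_
  · have h0 : (((0 : ℂ × ℂ).1, Y (0 : ℂ × ℂ).2) : ℂ × ℂ) = 0 := by simp [hY0]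
    rwa [h0] at this
  · intro v hv
    rw [hder.self_of_nhds] at hv
    obtain ⟨h1, h2⟩ := Prod.mk.inj hv
    exact Prod.ext h1 ((mul_eq_zero.1 h2).resolve_left hY1)
  · filter_upwards [hder] with t ht
    refine (ht (1, 0)).trans ?_
    change _ = ((1, 0) : ℂ × ℂ)
    simp
  · filter_upwards [hder, hsnd.eventually hYf] with t ht hft u v
    rw [ht u, ht v]
    refine (ht _).trans ?_
    change ((planarBilin (f t.2) u v).1, deriv Y t.2 * (planarBilin (f t.2) u v).2)
      = planarBilin (Y t.2 ^ k) (u.1, deriv Y t.2 * u.2) (v.1, deriv Y t.2 * v.2)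
    rw [← hft, planarBilin_apply, planarBilin_apply]
    ext <;> simp <;> ring

end NormalForms

/-! ### Semisimple points under germ isomorphisms. -/

section Classification

open Set Filter

variable {E : Type*} [NormedAddCommGroup E] [NormedSpace ℂ E]
  {H : Type*} [TopologicalSpace H] {I : ModelWithCorners ℂ E H}
  {M : Type*} [TopologicalSpace M] [ChartedSpace H M]
  {E' : Type*} [NormedAddCommGroup E'] [NormedSpace ℂ E']
  {H' : Type*} [TopologicalSpace H'] {I' : ModelWithCorners ℂ E' H'}
  {M' : Type*} [TopologicalSpace M'] [ChartedSpace H' M']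

theorem isSemisimpleAt_iff_of_bijective {A : TangentMul I M} {A' : TangentMul I' M'} {p : M}
    {p' : M'} {L : TangentSpace I p →L[ℂ] TangentSpace I' p'} (hL : Function.Bijective L)
    (h : ∀ u v, L (A.mul p u v) = A'.mul p' (L u) (L v)) :
    A.IsSemisimpleAt p ↔ A'.IsSemisimpleAt p' := by
  let e : TangentSpace I p ≃ₗ[ℂ] TangentSpace I' p' := LinearEquiv.ofBijective (L : _ →ₗ[ℂ] _) hL
  have he : ∀ u v, e (A.mul p u v) = A'.mul p' (e u) (e v) := h
  refine ⟨fun hs => hs.map e he, fun hs => hs.map e.symm fun u v => ?_⟩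
  apply e.injective
  rw [he, e.apply_symm_apply, e.apply_symm_apply, e.apply_symm_apply]

theorem GermIso.exists_isSemisimpleAt_iff {A : TangentMul I M} {A' : TangentMul I' M'} {p : M}
    {p' : M'} (h : GermIso A p A' p') :
    ∃ φ : OpenPartialHomeomorph M M', p ∈ φ.source ∧
      ∀ q ∈ φ.source, A.IsSemisimpleAt q ↔ A'.IsSemisimpleAt (φ q) := by
  obtain ⟨φ, hp, -, h1, h2, h3⟩ := h
  have hφ := openPartialHomeomorph_mdifferentiable h1 h2
  exact ⟨φ, hp, fun q hq => isSemisimpleAt_iff_of_bijective (hφ.mfderiv hq).bijective (h3 q hq).2⟩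

theorem GermIso.mem_interior_not_isSemisimpleAt {A : TangentMul I M} {p : M} {p' : ℂ × ℂ}
    (h : GermIso A p nilpotentPlane p') : p ∈ interior {q | ¬ A.IsSemisimpleAt q} := by
  obtain ⟨φ, hp, hφ⟩ := h.exists_isSemisimpleAt_iff
  refine mem_interior.2 ⟨φ.source, fun q hq => ?_, φ.open_source, hp⟩
  exact fun hs => (planarMul_isSemisimpleAt_iff _ _).1 ((hφ q hq).1 hs) rfl

/-- Semisimplicity transports along the isomorphism, and in `I₂(m)` every nonempty open set meets
`t₂ ≠ 0`, where the algebra is semisimple. -/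
theorem GermIso.notMem_closure_interior_not_isSemisimpleAt {A : TangentMul I M} {p : M}
    {p' : ℂ × ℂ} {m : ℕ} (h : GermIso A p (I2 m) p') :
    p ∉ closure (interior {q | ¬ A.IsSemisimpleAt q}) := by
  obtain ⟨φ, hp, hφ⟩ := h.exists_isSemisimpleAt_iff
  intro hc
  obtain ⟨q, hq, hqS⟩ := mem_closure_iff.1 hc φ.source φ.open_source hp
  have ho : IsOpen (φ '' (φ.source ∩ interior {q | ¬ A.IsSemisimpleAt q})) :=
    φ.isOpen_image_of_subset_source (φ.open_source.inter isOpen_interior) inter_subset_left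
  obtain ⟨t, ht, q', ⟨hq's, hq'S⟩, rfl⟩ :=
    dense_iff_inter_open.1 dense_snd_ne_zero _ ho ⟨φ q, mem_image_of_mem _ ⟨hq, hqS⟩⟩ |>.imp
      fun _ => And.symm
  refine interior_subset hq'S ((hφ q' hq's).2 ?_)
  exact (planarMul_isSemisimpleAt_iff _ _).2 (pow_ne_zero _ ht)

theorem isMassive_iff_interior_eq_empty {A : TangentMul I M} :
    A.IsMassive ↔ interior {q | ¬ A.IsSemisimpleAt q} = ∅ := by
  rw [interior_eq_empty_iff_dense_compl]
  simp only [TangentMul.IsMassive, compl_ofPred, not_not]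

end Classification

/-! ### From the local dichotomy to the classification. -/

section PlanarClassification

open Set Filter

variable {M : Type*} [TopologicalSpace M] [ChartedSpace (ℂ × ℂ) M]
  [IsManifold 𝓘(ℂ, ℂ × ℂ) ω M] {A : TangentMul 𝓘(ℂ, ℂ × ℂ) M}

theorem TangentMul.IsFManifold.germIso_nilpotentPlane_or_I2 (hA : A.IsFManifold) (p : M) :
    GermIso A p nilpotentPlane (0 : ℂ × ℂ) ∨ ∃ k : ℕ, GermIso A p (I2 (k + 2)) (0 : ℂ × ℂ) := by
  obtain ⟨m, hm, hm1, h1⟩ := hA.exists_germIso_planarMulOfSq p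
  obtain ⟨f, hf, h2⟩ := germIso_planarMulOfSq_planarMul hm hm1
  by_cases h0 : ∀ᶠ z in 𝓝 0, f z = 0
  · exact .inl ((h1.trans h2).trans (germIso_planarMul_nilpotentPlane h0))
  · obtain ⟨k, h3⟩ := germIso_planarMul_I2 hf h0
    exact .inr ⟨k, (h1.trans h2).trans h3⟩

/-- A point of the closure cannot have a germ of type `I₂(m)`, so it has the nilpotent one and lies
in the interior. -/
theorem TangentMul.IsFManifold.isClopen_interior_not_isSemisimpleAt (hA : A.IsFManifold) :
    IsClopen (interior {q | ¬ A.IsSemisimpleAt q}) := by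
  refine ⟨isClosed_of_closure_subset fun p hp => ?_, isOpen_interior⟩
  rcases hA.germIso_nilpotentPlane_or_I2 p with h | ⟨k, h⟩
  · exact h.mem_interior_not_isSemisimpleAt
  · exact absurd hp h.notMem_closure_interior_not_isSemisimpleAt

theorem TangentMul.IsFManifold.exists_germIso_I2 (hA : A.IsFManifold) (hm : A.IsMassive) (p : M) :
    ∃ k : ℕ, GermIso A p (I2 (k + 2)) (0 : ℂ × ℂ) := by
  refine (hA.germIso_nilpotentPlane_or_I2 p).resolve_left fun h => ?_
  have := h.mem_interior_not_isSemisimpleAt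
  rw [isMassive_iff_interior_eq_empty.1 hm] at this
  exact this

theorem TangentMul.IsFManifold.germIso_nilpotentPlane (hA : A.IsFManifold) (hm : ¬ A.IsMassive)
    (p : M) : GermIso A p nilpotentPlane (0 : ℂ × ℂ) := by
  refine (hA.germIso_nilpotentPlane_or_I2 p).resolve_right ?_
  rintro ⟨k, h⟩
  have := hA.connected
  rcases isClopen_iff.1 hA.isClopen_interior_not_isSemisimpleAt with h0 | h0
  · exact hm (isMassive_iff_interior_eq_empty.2 h0)
  · refine h.notMem_closure_interior_not_isSemisimpleAt (subset_closure ?_)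
    rw [h0]
    trivial

end PlanarClassification

/-! ### The number `m` is an invariant of the germ. -/

section Uniqueness

open Set Filter

/-- The image `(δ, γ)` of `∂₂` has square `b ∂₁`, so `2δγ = 0`. Injectivity excludes `γ = 0`, whence
`δ = 0` and `b = c γ²`. -/
theorem planarBilin_intertwine {b c : ℂ} {L : ℂ × ℂ →L[ℂ] ℂ × ℂ} (hL : Function.Injective L)
    (h1 : L (1, 0) = (1, 0)) (h : ∀ u v, L (planarBilin b u v) = planarBilin c (L u) (L v)) :
    (L (0, 1)).2 ≠ 0 ∧ b = c * (L (0, 1)).2 ^ 2 := by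
  have h2 := h (0, 1) (0, 1)
  simp only [planarBilin_apply] at h2
  have h3 : L (b, 0) = (b, 0) := by
    have : ((b, 0) : ℂ × ℂ) = b • (1, 0) := by simp
    rw [this, map_smul, h1]
  have hγ : (L (0, 1)).2 ≠ 0 := by
    intro h0
    have : L (0, 1) = L ((L (0, 1)).1, 0) := by
      have h4 : (((L (0, 1)).1, 0) : ℂ × ℂ) = (L (0, 1)).1 • (1, 0) := by simp
      rw [h4, map_smul, h1, ← h4]
      exact Prod.ext rfl h0
    simpa using congrArg Prod.snd (hL this)
  simp only [mul_zero, mul_one, zero_add, add_zero] at h2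
  rw [h3] at h2
  obtain ⟨h5, h6⟩ := Prod.mk.inj h2
  have h7 : (L (0, 1)).1 * (L (0, 1)).2 = 0 := by linear_combination -h6 / 2
  have h8 := (mul_eq_zero.1 h7).resolve_right hγ
  rw [h8] at h5
  exact ⟨hγ, by linear_combination h5⟩

/-- After division by `t^k` the right side is `(y/t)^k y^(l-k) (y')²`, which tends to `0` because
`y` does. -/
theorem not_eventually_pow_eq_pow_mul_deriv_sq {k l : ℕ} (hkl : k < l) {y : ℂ → ℂ}
    (hy : AnalyticAt ℂ y 0) (hy0 : y 0 = 0) :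
    ¬ ∀ᶠ t in 𝓝 (0 : ℂ), t ^ k = y t ^ l * deriv y t ^ 2 := by
  intro h
  have hd : Tendsto (fun t => t⁻¹ * y t) (𝓝[≠] 0) (𝓝 (deriv y 0)) := by
    have := hasDerivAt_iff_tendsto_slope.1 hy.differentiableAt.hasDerivAt
    refine this.congr fun t => ?_
    simp [slope, hy0]
  have hyc : Tendsto y (𝓝[≠] 0) (𝓝 0) := by
    have := hy.continuousAt.tendsto.mono_left (nhdsWithin_le_nhds (s := {(0 : ℂ)}ᶜ))
    rwa [hy0] at this
  have hdc : Tendsto (deriv y) (𝓝[≠] 0) (𝓝 (deriv y 0)) :=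
    hy.deriv.continuousAt.tendsto.mono_left nhdsWithin_le_nhds
  have hlim := ((hd.pow k).mul (hyc.pow (l - k))).mul (hdc.pow 2)
  rw [zero_pow (Nat.sub_ne_zero_of_lt hkl), mul_zero, zero_mul] at hlim
  refine one_ne_zero (tendsto_nhds_unique ((tendsto_const_nhds (x := (1 : ℂ))).congr' ?_) hlim)
  filter_upwards [nhdsWithin_le_nhds h, self_mem_nhdsWithin] with t ht ht0
  have ht0 : t ≠ 0 := ht0
  have hsplit : y t ^ l = y t ^ k * y t ^ (l - k) := by rw [← pow_add, Nat.add_sub_cancel' hkl.le]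
  rw [hsplit] at ht
  calc (1 : ℂ) = (t⁻¹) ^ k * t ^ k := by rw [← mul_pow, inv_mul_cancel₀ ht0, one_pow]
    _ = _ := by rw [ht]; ring

/-- On the line `t₁ = 0` let `y` be the second component of the isomorphism. Comparing the algebras
pointwise gives `t^(m-2) = y^(n-2) (y')²`. -/
theorem GermIso.I2_not_lt {m n : ℕ} (h : GermIso (I2 m) (0 : ℂ × ℂ) (I2 n) (0 : ℂ × ℂ)) :
    ¬ m - 2 < n - 2 := by
  intro hlt
  obtain ⟨φ, hp, hp0, h1, h2, h3⟩ := h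
  have hφ := openPartialHomeomorph_mdifferentiable h1 h2
  have ha : ∀ t ∈ φ.source, AnalyticAt ℂ φ t := fun t ht =>
    ((contMDiffOn_iff_contDiffOn.1 h1).contDiffAt (φ.open_source.mem_nhds ht)).analyticAt
  have hmap : ∀ s : ℂ, HasDerivAt (fun s : ℂ => ((0 : ℂ), s)) (0, 1) s := fun s =>
    (hasDerivAt_const s (0 : ℂ)).prodMk (hasDerivAt_id s)
  have hline : ∀ s : ℂ, (0, s) ∈ φ.source →
      HasDerivAt (fun s => (φ (0, s)).2) (fderiv ℂ φ (0, s) (0, 1)).2 s := fun s hs =>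
    ((ha _ hs).differentiableAt.hasFDerivAt.comp_hasDerivAt s (hmap s)).snd
  have hy : AnalyticAt ℂ (fun s => (φ (0, s)).2) 0 :=
    analyticAt_snd.comp (AnalyticAt.comp (f := fun s : ℂ => ((0 : ℂ), s)) (ha _ hp)
      (analyticAt_const.prod analyticAt_id))
  refine not_eventually_pow_eq_pow_mul_deriv_sq hlt hy (congrArg Prod.snd hp0) ?_
  have hev : ∀ᶠ s in 𝓝 (0 : ℂ), ((0 : ℂ), s) ∈ φ.source :=
    (hmap 0).continuousAt.eventually (φ.open_source.mem_nhds hp)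
  filter_upwards [hev] with s hs
  rw [(hline s hs).deriv]
  have hinj : Function.Injective (fderiv ℂ φ (0, s)) := by
    have := (hφ.mfderiv hs).injective
    have he : mfderiv 𝓘(ℂ, ℂ × ℂ) 𝓘(ℂ, ℂ × ℂ) φ (0, s) = fderiv ℂ φ (0, s) := mfderiv_eq_fderiv
    exact he ▸ this
  obtain ⟨hu, hm⟩ := h3 _ hs
  rw [mfderiv_eq_fderiv] at hu hm
  exact (planarBilin_intertwine hinj hu hm).2

theorem GermIso.I2_eq {m n : ℕ} (hm : 2 ≤ m) (hn : 2 ≤ n)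
    (h : GermIso (I2 m) (0 : ℂ × ℂ) (I2 n) (0 : ℂ × ℂ)) : m = n := by
  have h1 := h.I2_not_lt
  have h2 := h.symm.I2_not_lt
  omega

end Uniqueness

/-! ### Irreducibility for `m ≥ 3`. -/

section Irreducibility

theorem planarBilin_zero_idempotent {u : ℂ × ℂ} (h : planarBilin 0 u u = u) :
    u = 0 ∨ u = (1, 0) := by
  rw [planarBilin_apply] at h
  obtain ⟨h1, h2⟩ := Prod.ext_iff.1 h
  simp only [zero_mul, add_zero] at h1 h2
  have h3 : u.1 * (u.1 - 1) = 0 := by linear_combination h1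
  rcases mul_eq_zero.1 h3 with h4 | h4
  · left
    rw [h4] at h2
    exact Prod.ext h4 (by simpa using h2.symm)
  · right
    have h5 : u.1 = 1 := sub_eq_zero.1 h4
    rw [h5] at h2
    exact Prod.ext h5 (by linear_combination h2)

/-- In a product, `(e₁, 0)` is an idempotent other than `0` and the unit. For `m ≥ 3` the algebra at
the origin is `ℂ[x]/(x²)`, which has no such idempotent. -/
theorem I2_isIrreducibleAt {m : ℕ} (hm : 3 ≤ m) : (I2 m).IsIrreducibleAt (0 : ℂ × ℂ) := by
  rintro ⟨n₁, n₂, M₁, M₂, _, _, _, _, _, _, A₁, A₂, p₁, p₂, h₁, h₂, h⟩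
  obtain ⟨L, hL, hL1, hLm⟩ := h.exists_continuousLinearEquiv
  let u : EuclideanSpace ℂ (Fin n₁) × EuclideanSpace ℂ (Fin n₂) := (A₁.unit p₁, 0)
  have hu : (A₁.prod A₂).mul (p₁, p₂) u u = u :=
    Prod.ext (h₁.unit_mul p₁ _) (map_zero (A₂.mul p₂ 0))
  have h3 : (I2 m).mul (0 : ℂ × ℂ) (L u) (L u) = L u := (hLm u u).symm.trans (congrArg L hu)
  have h4 : planarBilin 0 (L u) (L u) = L u := by
    have h5 : ((0 : ℂ × ℂ).2) ^ (m - 2) = 0 := zero_pow (by omega)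
    rw [← h5]
    exact h3
  rcases planarBilin_zero_idempotent h4 with h5 | h5
  · have h6 : u = 0 := hL.injective (h5.trans (map_zero L).symm)
    exact h₁.unit_ne_zero p₁ (congrArg Prod.fst h6)
  · have h6 : u = (A₁.prod A₂).unit (p₁, p₂) := hL.injective (h5.trans hL1.symm)
    exact h₂.unit_ne_zero p₂ (congrArg Prod.snd h6).symm

end Irreducibility

end FMfd

theorem theorem12p1 :
    -- the germs of two-dimensional massive F-manifolds are exactly the `I₂(m)`, `m ≥ 2`
    (∀ m : ℕ, 2 ≤ m → (FMfd.I2 m).IsFManifold ∧ (FMfd.I2 m).IsMassive) ∧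
    (∀ (M : Type*) [TopologicalSpace M] [ChartedSpace (ℂ × ℂ) M] [IsManifold 𝓘(ℂ, ℂ × ℂ) ω M]
      (A : FMfd.TangentMul 𝓘(ℂ, ℂ × ℂ) M), A.IsFManifold → A.IsMassive →
      ∀ p : M, ∃! m : ℕ, 2 ≤ m ∧ FMfd.GermIso A p (FMfd.I2 m) (0 : ℂ × ℂ)) ∧
    FMfd.GermIso (FMfd.I2 2) (0 : ℂ × ℂ) FMfd.A1Sq (0 : ℂ × ℂ) ∧
    -- Euler field of weight one and its discriminant
    (∀ m : ℕ, 2 ≤ m → (FMfd.I2 m).IsEulerField 1 (FMfd.eulerI2 m) ∧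
      (FMfd.I2 m).discriminant (FMfd.eulerI2 m)
        = {t : ℂ × ℂ | t.1 ^ 2 - 4 / (m : ℂ) ^ 2 * t.2 ^ m = 0}) ∧
    -- irreducibility, caustic, bifurcation diagram and Euler fields for `m ≥ 3`
    (∀ m : ℕ, 3 ≤ m → (FMfd.I2 m).IsIrreducibleAt (0 : ℂ × ℂ) ∧
      (FMfd.I2 m).caustic = {t : ℂ × ℂ | t.2 = 0} ∧
      (FMfd.I2 m).bifurcationDiagram (FMfd.eulerI2 m) = {t : ℂ × ℂ | t.2 = 0} ∧
      ∀ (d : ℂ) (X : ∀ t : ℂ × ℂ, TangentSpace 𝓘(ℂ, ℂ × ℂ) t),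
        (FMfd.I2 m).IsEulerGermAt (0 : ℂ × ℂ) d X ↔
          ∃ c : ℂ, ∀ᶠ t in 𝓝 (0 : ℂ × ℂ), X t = d • FMfd.eulerI2 m t + c • (FMfd.I2 m).unit t) ∧
    -- the only germ of a two-dimensional F-manifold that is not massive
    (FMfd.nilpotentPlane.IsFManifold ∧ ¬ FMfd.nilpotentPlane.IsMassive) ∧
    (∀ (M : Type*) [TopologicalSpace M] [ChartedSpace (ℂ × ℂ) M] [IsManifold 𝓘(ℂ, ℂ × ℂ) ω M]
      (A : FMfd.TangentMul 𝓘(ℂ, ℂ × ℂ) M), A.IsFManifold → ¬ A.IsMassive →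
      ∀ p : M, FMfd.GermIso A p FMfd.nilpotentPlane (0 : ℂ × ℂ)) ∧
    FMfd.nilpotentPlane.caustic = ∅ ∧
    FMfd.nilpotentPlane.IsEulerField 1 (fun t : ℂ × ℂ => ((t.1, 0) : ℂ × ℂ)) ∧
    (∀ X : ∀ t : ℂ × ℂ, TangentSpace 𝓘(ℂ, ℂ × ℂ) t,
      FMfd.nilpotentPlane.IsEulerGermAt (0 : ℂ × ℂ) 0 X ↔
        ∃ (ε₁ : ℂ) (ε₂ : ℂ → ℂ), AnalyticAt ℂ ε₂ 0 ∧
          ∀ᶠ t in 𝓝 (0 : ℂ × ℂ), X t = ((ε₁, ε₂ t.2) : ℂ × ℂ)) := by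
  refine ⟨fun m _ => ⟨FMfd.I2_isFManifold m, FMfd.I2_isMassive m⟩, ?_, FMfd.I2_two_germIso_A1Sq,
    fun m hm => ⟨FMfd.I2_isEulerField hm, FMfd.I2_discriminant hm⟩,
    fun m hm => ⟨FMfd.I2_isIrreducibleAt hm, FMfd.I2_caustic hm, FMfd.I2_bifurcationDiagram hm,
      FMfd.I2_isEulerGermAt_iff hm⟩,
    ⟨FMfd.nilpotentPlane_isFManifold, FMfd.nilpotentPlane_not_isMassive⟩, ?_,
    FMfd.nilpotentPlane_caustic, FMfd.nilpotentPlane_isEulerField,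
    FMfd.nilpotentPlane_isEulerGermAt_iff⟩
  · intro M _ _ _ A hA hm p
    obtain ⟨k, h⟩ := hA.exists_germIso_I2 hm p
    exact ⟨k + 2, ⟨by omega, h⟩, fun n hn => (hn.2.symm.trans h).I2_eq hn.1 (by omega)⟩
  · intro M _ _ _ A hA hm p
    exact hA.germIso_nilpotentPlane hm p
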